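/- **Setting.** Consider a deterministic contextual MDP with horizon $H$: discrete state and action spaces $\mathcal S,\mathcal A$, initial state $s_1\sim\rho$, deterministic transitions, reward $r(s,a)$. A trajectory is $\tau=(s_1,a_1,\dots,s_H,a_H)$, with $r(\tau)=\sum_h r(s_h,a_h)\in[0,R_{\max}]$. Policies may depend on the step, and $\pi(\tau)=\prod_h\pi_h(a_h\mid s_h)$. Given two trajectories from the same $s_1$, the preference oracle prefers $\tau$ over $\tilde\tau$ with probability $e^{r(\tau)}/(e^{r(\tau)}+e^{r(\tilde\tau)})$. Fix a reference policy $\pi_{\rm ref}$ and $\beta>0$, and let $J_\beta(\pi)=\mathbb E_\pi[r(\tau)-\beta\log\frac{\pi(\tau)}{\pi_{\rm ref}(\tau)}]$ ($=-\infty$ if the divergence is infinite). Let $\Pi\ni\pi_{\rm ref}$ be a finite policy class. Let $\pi_{\rm samp}$ be a sampling strategy that maps each finite (possibly empty) sequence of policies in $\Pi$ to a conditional law of trajectories given $s_1$, supported on trajectories with $\pi_{\rm ref}(\tau)>0$. The offline data are $N_{\rm off}\ge1$ fixed pairs of trajectories with a common initial state in the support of $\rho$ and with positive probability under $\pi_{\rm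 ref}$; they are labelled independently by the preference oracle, which gives $\mathcal D_{\rm off}$. **Algorithm (HPO)**, with parameters $T\ge 2$, $\alpha$, $\gamma\in\mathbb N$. Start with $\pi^{(1)}=\tilde\pi^{(1)}=\pi_{\rm ref}$. For $t=1,\dots,T$: (i) draw $s_1\sim\rho$, $\tau\sim\pi^{(t)}\mid s_1$, $\tilde\tau\sim\tilde\pi^{(t)}\mid s_1$, have the pair labelled by the oracle and add it to the online buffer; (ii) draw $\gamma$ labelled pairs from $\mathcal D_{\rm off}$ uniformly with replacement (a fresh batch in each iteration), and let $\mathcal D^{(t)}_{\rm hyb}$ be the online buffer together with this batch; (iii) draw $\mathcal D^{(t)}_{\rm opt}$, consisting of $t+\gamma$ independent trajectories with $s_1\sim\rho$, $\tau\sim\tilde\pi^{(t)}\mid s_1$; (iv) let $\pi^{(t+1)}$ be a minimizer over $\pi\in\Pi$ (ties broken arbitrarily) of $$\alpha\sum_{\tau\in\mathcal D^{(t)}_{\rm opt}}\log\pi(\tau)-\sum_{(\tau^+,\tau^-)\in\mathcal D^{(t)}_{\rm hyb}}\log\sigma\Big(\beta\log\tfrac{\pi(\tau^+)}{\pi_{\rm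 ref}(\tau^+)}-\beta\log\tfrac{\pi(\tau^-)}{\pi_{\rm ref}(\tau^-)}\Big),\qquad \sigma(x)=\tfrac1{1+e^{-x}};$$ (v) let $\tilde\pi^{(t+1)}=\pi_{\rm samp}(\pi^{(1)},\dots,\pi^{(t+1)})$. Return $\hat\pi\in\arg\max\{J_\beta(\pi):\pi\in\{\pi^{(1)},\dots,\pi^{(T)}\}\}$. **Hybrid SEC.** Let $$g^{(\pi)}(\tau,\tilde\tau)=\beta\log\tfrac{\pi(\tau)}{\pi_{\rm ref}(\tau)}-r(\tau)-\beta\log\tfrac{\pi(\tilde\tau)}{\pi_{\rm ref}(\tilde\tau)}+r(\tilde\tau),\qquad C^{(\pi)}_{\rm off}=\frac1{N_{\rm off}}\sum_{(\tau_+,\tau_-)\in\mathcal D_{\rm off}}g^{(\pi)}(\tau_+,\tau_-)^2,$$ and, with $\tilde\pi^{(t)}=\pi_{\rm samp}(\pi^{(1)},\dots,\pi^{(t)})$ for $t\ge0$ and $\pi\otimes\tilde\pi$ denoting the law of $(\tau,\tilde\tau)$ for $s_1\sim\rho$, $\tau\sim\pi\mid s_1$, $\tilde\tau\sim\tilde\pi\mid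 s_1$, $$\mathsf{SEC}=\sup_{\pi^{(1)},\dots,\pi^{(T)}\in\Pi}\ \sum_{t=1}^T\frac{\big(\mathbb E_{\pi^{(t)}\otimes\tilde\pi^{(t-1)}}[g^{(\pi^{(t)})}]\big)^2}{V_{\max}^2\vee\Big[\sum_{i=1}^{t-1}\mathbb E_{\pi^{(i)}\otimes\tilde\pi^{(i)}}\big[(g^{(\pi^{(t)})})^2\big]+\gamma\,C^{(\pi^{(t)})}_{\rm off}\Big]}.$$ **Theorem.** There is an absolute constant $c>0$, and for every $\varepsilon>0$ a constant $C>0$ depending only on $\varepsilon$, such that the following holds. Assume 1. (realizability) $\Pi$ contains an optimal policy $\pi^\star_\beta$, i.e. one that maximizes $J_\beta$ over all policies; 2. (bounded log density ratios) $|\log(\pi(\tau)/\pi_{\rm ref}(\tau))|\le V_{\max}/\beta$ for all $\pi\in\Pi$ and all trajectories $\tau$ (where $\pi(\tau)$ and $\pi_{\rm ref}(\tau)$ may vanish only together); 3. $T\ge2$, and $T\le N_{\rm off}$ unless $\gamma=0$; 4. (nondegeneracy) $V_{\max}+R_{\max}\ge\varepsilon$ and $(1+\gamma/T)\cdot\mathsf{SEC}\cdot\log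 T\ge\varepsilon$. Let $\delta\in(0,1)$ and $$\alpha=c\cdot\frac{\beta}{(V_{\max}+R_{\max})e^{2R_{\max}}}\sqrt{\frac{\log(|\Pi|T\delta^{-1})\log T}{(T+\gamma)\cdot\mathsf{SEC}}}.$$ Then, with probability at least $1-\delta$ (over the offline labels and the run of the algorithm), the policy returned by HPO satisfies $$J_\beta(\pi^\star_\beta)-J_\beta(\hat\pi)\le C\,(V_{\max}+R_{\max})e^{2R_{\max}}\sqrt{\frac{(1+\gamma/T)\cdot\mathsf{SEC}\cdot\log(|\Pi|T\delta^{-1})\log T}{T}}.$$ -/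

import Mathlib

namespace HPO

noncomputable section

/-- Expectation of a real function under a discrete distribution. -/
def expect {α : Type*} (p : PMF α) (f : α → ℝ) : ℝ := ∑' x, (p x).toReal * f x

/-- The product of `n` discrete distributions: `n` independent draws. -/
def indep {α : Type*} : (n : ℕ) → (Fin n → PMF α) → PMF (Fin n → α)
  | 0, _ => PMF.pure Fin.elim0
  | n + 1, p => (p 0).bind fun x => (indep n fun i => p i.succ).map (Fin.cons x)

/-- A deterministic contextual Markov decision process: the initial state (prompt) is random,
the transitions are deterministic. -/
structure DCMDP (S A : Type*) where
  /-- the initial state distribution `ρ` -/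
  init : PMF S
  /-- the transition function -/
  next : S → A → S
  /-- the reward function -/
  reward : S → A → ℝ

/-- A randomized policy; it may depend on the step `h`. -/
abbrev Policy (S A : Type*) (H : ℕ) := Fin H → S → PMF A

/-- A trajectory, given by its initial state and its actions; since transitions are
deterministic, these determine the visited states, see `DCMDP.stateAt`. -/
abbrev Traj (S A : Type*) (H : ℕ) := S × (Fin H → A)

/-- A way of drawing a trajectory (that is, its actions) given its initial state. -/
abbrev Sampler (S A : Type*) (H : ℕ) := S → PMF (Fin H → A)

namespace DCMDP

variable {S A : Type*} {H : ℕ} (M : DCMDP S A)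

/-- The state after `h` steps (so `stateAt s a 0` is the initial state). -/
def stateAt (s : S) (a : Fin H → A) : ℕ → S
  | 0 => s
  | h + 1 => if hh : h < H then M.next (stateAt s a h) (a ⟨h, hh⟩) else stateAt s a h

/-- The total reward `r(τ) = ∑ₕ r(sₕ, aₕ)`. -/
def totalReward (τ : Traj S A H) : ℝ := ∑ h : Fin H, M.reward (M.stateAt τ.1 τ.2 h) (τ.2 h)

/-- `π(τ) = ∏ₕ π(aₕ | sₕ)`. -/
def prob (π : Policy S A H) (τ : Traj S A H) : ℝ :=
  ∏ h : Fin H, (π h (M.stateAt τ.1 τ.2 h) (τ.2 h)).toReal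

/-- The law of the actions when `π` is run from a given initial state. -/
def rollout : (n : ℕ) → (Fin n → S → PMF A) → S → PMF (Fin n → A)
  | 0, _, _ => PMF.pure Fin.elim0
  | n + 1, π, s => (π 0 s).bind fun a =>
      (rollout n (fun h => π h.succ) (M.next s a)).map (Fin.cons a)

/-- A policy as a way of drawing trajectories. -/
def sampler (π : Policy S A H) : Sampler S A H := M.rollout H π

/-- The law of `τ`, where `s₁ ∼ ρ` and `τ ∼ p | s₁`. -/
def trajLaw (p : Sampler S A H) : PMF (Traj S A H) :=
  M.init.bind fun s => (p s).map fun a => (s, a)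

/-- The law of `(τ, τ̃)`, where `s₁ ∼ ρ` and `(τ, τ̃) ∼ p ⊗ q | s₁`; the pair is recorded as
the common initial state and the two action sequences. -/
def pairLaw (p q : Sampler S A H) : PMF (S × (Fin H → A) × (Fin H → A)) :=
  M.init.bind fun s => (p s).bind fun a => (q s).map fun b => (s, a, b)

/-- The Bradley–Terry probability that `τ` is preferred over `τ'`. -/
def prefProb (τ τ' : Traj S A H) : ℝ :=
  Real.exp (M.totalReward τ) / (Real.exp (M.totalReward τ) + Real.exp (M.totalReward τ'))

lemma prefProb_add (τ τ' : Traj S A H) : M.prefProb τ τ' + M.prefProb τ' τ = 1 := by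
  have h1 := Real.exp_pos (M.totalReward τ)
  have h2 := Real.exp_pos (M.totalReward τ')
  unfold prefProb
  field_simp
  ring

/-- The preference oracle: returns the labelled pair (preferred trajectory, other trajectory),
for a pair of trajectories with a common initial state. -/
def label (x : S × (Fin H → A) × (Fin H → A)) : PMF (Traj S A H × Traj S A H) :=
  (PMF.ofFintype
    (fun y : Bool => ENNReal.ofReal
      (if y then M.prefProb (x.1, x.2.1) (x.1, x.2.2) else M.prefProb (x.1, x.2.2) (x.1, x.2.1)))
    (by
      have h0 : ∀ τ τ' : Traj S A H, 0 ≤ M.prefProb τ τ' := fun τ τ' => by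
        unfold prefProb; positivity
      rw [Fintype.sum_bool]
      simp only [if_true, Bool.false_eq_true, if_false]
      rw [← ENNReal.ofReal_add (h0 _ _) (h0 _ _), prefProb_add, ENNReal.ofReal_one])).map
    fun y => if y then ((x.1, x.2.1), (x.1, x.2.2)) else ((x.1, x.2.2), (x.1, x.2.1))

end DCMDP

/-- The data of a hybrid RLHF problem with horizon `H` and `N` offline pairs. -/
structure Problem (S A : Type*) (H N : ℕ) where
  /-- the environment -/
  mdp : DCMDP S A
  /-- the reference policy -/
  ref : Policy S A H
  /-- the regularization parameter -/
  β : ℝ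
  /-- the policy class `Π` -/
  cls : Finset (Policy S A H)
  /-- the offline pairs of trajectories (each with a common initial state), before labelling -/
  offPairs : Fin N → S × (Fin H → A) × (Fin H → A)
  /-- the number of offline pairs drawn in each iteration -/
  γ : ℕ
  /-- the sampling strategy `π_samp`, a function of `π⁽¹⁾, …, π⁽ᵗ⁾` (also for `t = 0`) -/
  samp : List (Policy S A H) → Sampler S A H

/-- The state of the algorithm: the policies `π⁽¹⁾, …, π⁽ᵗ⁾` so far (in this order), the current
policy `π⁽ᵗ⁾`, the current sampler `π̃⁽ᵗ⁾`, and the online buffer of labelled pairs. -/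
structure RunState (S A : Type*) (H : ℕ) where
  policies : List (Policy S A H)
  current : Policy S A H
  sampler : Sampler S A H
  online : List (Traj S A H × Traj S A H)

/-- A rule that picks the next policy from the policies so far, the optimism dataset and the
hybrid preference dataset. -/
abbrev UpdateRule (S A : Type*) (H : ℕ) :=
  List (Policy S A H) → List (Traj S A H) → List (Traj S A H × Traj S A H) → Policy S A H

namespace Problem

variable {S A : Type*} {H N : ℕ} (P : Problem S A H N)

/-- `log (π(τ) / π_ref(τ))`. -/
def logRatio (π : Policy S A H) (τ : Traj S A H) : ℝ :=
  Real.log (P.mdp.prob π τ / P.mdp.prob P.ref τ)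

/-- The KL-regularized objective `J_β(π) = E_π[r(τ) - β log (π(τ) / π_ref(τ))]`, for policies of
finite divergence from the reference policy. -/
def J (π : Policy S A H) : ℝ :=
  expect (P.mdp.trajLaw (P.mdp.sampler π)) fun τ => P.mdp.totalReward τ - P.β * P.logRatio π τ

/-- The trajectory distribution of `π` has finite divergence from that of `π_ref`: absolute
continuity and integrability of the log-ratio. For all other policies `J_β(π) = -∞`. -/
def FiniteKL (π : Policy S A H) : Prop :=
  (∀ τ : Traj S A H, P.mdp.init τ.1 ≠ 0 → P.mdp.prob P.ref τ = 0 → P.mdp.prob π τ = 0) ∧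
  Summable fun τ => (P.mdp.trajLaw (P.mdp.sampler π) τ).toReal * P.logRatio π τ

/-- `π` is an optimal policy for `J_β` among all policies. -/
def IsOptimal (π : Policy S A H) : Prop :=
  P.FiniteKL π ∧ ∀ π', P.FiniteKL π' → P.J π' ≤ P.J π

/-- The total reward of every trajectory lies in `[0, R]`. -/
def RewardBounded (R : ℝ) : Prop :=
  ∀ τ : Traj S A H, 0 ≤ P.mdp.totalReward τ ∧ P.mdp.totalReward τ ≤ R

/-- `|log (π(τ) / π_ref(τ))| ≤ V / β` for all policies in the class and all trajectories; in
particular numerator and denominator can only vanish together. -/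
def RatioBounded (V : ℝ) : Prop :=
  ∀ π ∈ P.cls, ∀ τ : Traj S A H,
    (P.mdp.prob π τ = 0 ↔ P.mdp.prob P.ref τ = 0) ∧ |P.logRatio π τ| ≤ V / P.β

/-- The offline pairs consist of trajectories that are possible under `π_ref`. -/
def OfflinePossible : Prop :=
  ∀ i, P.mdp.init (P.offPairs i).1 ≠ 0 ∧
    P.mdp.prob P.ref ((P.offPairs i).1, (P.offPairs i).2.1) ≠ 0 ∧
    P.mdp.prob P.ref ((P.offPairs i).1, (P.offPairs i).2.2) ≠ 0

/-- The sampling strategy only produces trajectories that are possible under `π_ref`. -/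
def SampPossible : Prop :=
  ∀ l : List (Policy S A H), (∀ π ∈ l, π ∈ P.cls) →
    ∀ s a, P.mdp.prob P.ref (s, a) = 0 → P.samp l s a = 0

/-- `g^(π)(τ, τ̃)`, for a pair of trajectories with a common initial state. -/
def g (π : Policy S A H) (x : S × (Fin H → A) × (Fin H → A)) : ℝ :=
  P.β * P.logRatio π (x.1, x.2.1) - P.mdp.totalReward (x.1, x.2.1)
    - P.β * P.logRatio π (x.1, x.2.2) + P.mdp.totalReward (x.1, x.2.2)

/-- The offline coverage `C_off^(π)`. As `g²` is symmetric in the two trajectories, the labels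
do not matter. -/
def Coff (π : Policy S A H) : ℝ := (1 / (N : ℝ)) * ∑ i, (P.g π (P.offPairs i)) ^ 2

/-- `π̃⁽ᵗ⁾ = π_samp(π⁽¹⁾, …, π⁽ᵗ⁾)`, where `seq k` is `π⁽ᵏ⁺¹⁾`. -/
def sampAt {T : ℕ} (seq : Fin T → Policy S A H) (t : ℕ) : Sampler S A H :=
  P.samp ((List.ofFn seq).take t)

/-- The summand with (one-based) index `t = k + 1` of the hybrid coefficient. The sum over `j < k`
is `(t - 1) · E_{μ⁽ᵗ⁾}[(g^(π⁽ᵗ⁾))²]`. -/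
def secTerm (V : ℝ) {T : ℕ} (seq : Fin T → Policy S A H) (k : Fin T) : ℝ :=
  (expect (P.mdp.pairLaw (P.mdp.sampler (seq k)) (P.sampAt seq k)) (P.g (seq k))) ^ 2 /
    max (V ^ 2)
      ((∑ j : Fin T with j < k,
          expect (P.mdp.pairLaw (P.mdp.sampler (seq j)) (P.sampAt seq (j + 1)))
            (fun x => (P.g (seq k) x) ^ 2))
        + P.γ * P.Coff (seq k))

/-- The hybrid sequential extrapolation coefficient. -/
def SEC (V : ℝ) (T : ℕ) : ℝ :=
  ⨆ seq : Fin T → {π // π ∈ P.cls}, ∑ k : Fin T, P.secTerm V (fun i => (seq i : Policy S A H)) k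

/-- The objective minimized in the policy update, given the optimism dataset and the hybrid
preference dataset. -/
def loss (α : ℝ) (opt : List (Traj S A H)) (hyb : List (Traj S A H × Traj S A H))
    (π : Policy S A H) : ℝ :=
  α * (opt.map fun τ => Real.log (P.mdp.prob π τ)).sum
    - (hyb.map fun x =>
        Real.log (Real.sigmoid (P.β * P.logRatio π x.1 - P.β * P.logRatio π x.2))).sum

/-- The rule always picks a minimizer of the objective over the class (ties are broken
arbitrarily, possibly depending on all the data). -/
def IsArgminRule (α : ℝ) (upd : UpdateRule S A H) : Prop :=
  ∀ hist opt hyb, upd hist opt hyb ∈ P.cls ∧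
    ∀ π ∈ P.cls, P.loss α opt hyb (upd hist opt hyb) ≤ P.loss α opt hyb π

/-- One iteration of the algorithm; `off` is the labelled offline dataset. -/
def iter [NeZero N] (upd : UpdateRule S A H) (off : Fin N → Traj S A H × Traj S A H)
    (st : RunState S A H) : PMF (RunState S A H) :=
  ((P.mdp.pairLaw (P.mdp.sampler st.current) st.sampler).bind P.mdp.label).bind fun z =>
  (indep P.γ fun _ => (PMF.uniformOfFintype (Fin N)).map off).bind fun batch =>
  (indep (st.policies.length + P.γ) fun _ => P.mdp.trajLaw st.sampler).map fun opt =>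
    let online := st.online ++ [z]
    let new := upd st.policies (List.ofFn opt) (online ++ List.ofFn batch)
    { policies := st.policies ++ [new]
      current := new
      sampler := P.samp (st.policies ++ [new])
      online := online }

/-- The initial state: `π⁽¹⁾ = π̃⁽¹⁾ = π_ref`, and an empty online buffer. -/
def start : RunState S A H where
  policies := [P.ref]
  current := P.ref
  sampler := P.mdp.sampler P.ref
  online := []

/-- The law of the state after `t` iterations, with a given labelled offline dataset. -/
def runFrom [NeZero N] (upd : UpdateRule S A H) (off : Fin N → Traj S A H × Traj S A H) :
    ℕ → PMF (RunState S A H)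
  | 0 => PMF.pure P.start
  | t + 1 => (runFrom upd off t).bind (P.iter upd off)

/-- The law of the state after `T` iterations: the offline pairs are labelled independently by
the preference oracle, then the algorithm is run. -/
def run [NeZero N] (upd : UpdateRule S A H) (T : ℕ) : PMF (RunState S A H) :=
  (indep N fun i => P.mdp.label (P.offPairs i)).bind fun off => P.runFrom upd off T

/-- `π` is a possible output: it maximizes `J_β` over `π⁽¹⁾, …, π⁽ᵀ⁾`. -/
def IsOutput (T : ℕ) (st : RunState S A H) (π : Policy S A H) : Prop :=
  π ∈ st.policies.take T ∧ ∀ π' ∈ st.policies.take T, P.J π' ≤ P.J π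

end Problem

end

end HPO

/-! On possible trajectories the optimal policy is the Gibbs tilt of `π_ref`: β log(π*/π_ref) = r −
v(s₁), with v the soft value (`optimal_logRatio`). Hence π* models the labels exactly, and g^π is
the difference between the log-odds that π and π* give to a label. For every sampler q supported on
possible trajectories, the regret of π splits as β E_q[log π − log π*] + E_{π⊗q}[g^π]
(`Regular.regret_eq`).

The first term is controlled by optimism. Comparing the loss of the chosen π with that of π* bounds
α times the sum of log π − log π* over the optimism dataset by the log-likelihood ratio of π against
π* on the hybrid data (`optimism_le`). Under the true model E exp(llr/2) = 1 − h ≤ exp(−h), with h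
the squared Hellinger distance, so with high probability the online ratio is at most 2ℓ −
2·(cumulative h), uniformly over the class. This negative term pays for the second one: g² ≤ κ'·h,
so the denominator of the extrapolation coefficient is at most κ'·h plus a constant, and after a
weighted AM-GM it cancels (`StepOK.regret_le`). With n = t + γ samples, a round leaves terms of
order 1/(α n), 1/√n and α·n·(summand of SEC). Their sums, of order log((T+γ)/(1+γ))/α, √T and α
(T+γ) SEC, are balanced by the prescribed α.

The offline part needs more care, since all batches resample the same N labels. Given the labels, a
batch is i.i.d., and what matters is the average of exp(s·llr) over the labels. For s ≤ 1/4 this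
variable is bounded, because llr ≤ 1 + R, and its upper deviations are controlled by the
half-likelihood moment (`exp_tempered_le`). The price is a factor (1 + 2(γ/N) e^{s(1+R)})/s, made
harmless by the choice of s in `exists_tempering`: if γ is large, then log((T+γ)/(1+γ)) is small.
There R ≤ log T may be assumed, since otherwise the claimed bound exceeds the trivial 2(V+R)
(`reward_le_log`). -/

open scoped ENNReal

namespace HPO

noncomputable section

/-- Expectation of an extended nonnegative function under a discrete distribution. -/
def lexpect {α : Type*} (p : PMF α) (f : α → ℝ≥0∞) : ℝ≥0∞ := ∑' x, p x * f x

/-! ### Nonnegative expectations, independence and the exponential Markov inequality -/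

section lexpect

variable {α γ : Type*}

lemma lexpect_pure (a : α) (f : α → ℝ≥0∞) : lexpect (PMF.pure a) f = f a := by
  unfold lexpect
  rw [tsum_eq_single a]
  · simp
  · intro b hb
    simp [PMF.pure_apply, hb]

lemma lexpect_bind (p : PMF α) (k : α → PMF γ) (f : γ → ℝ≥0∞) :
    lexpect (p.bind k) f = lexpect p fun x => lexpect (k x) f := by
  unfold lexpect
  simp only [PMF.bind_apply, ← ENNReal.tsum_mul_right, ← ENNReal.tsum_mul_left]
  rw [ENNReal.tsum_comm]
  simp only [mul_assoc]

lemma lexpect_map (p : PMF α) (k : α → γ) (f : γ → ℝ≥0∞) :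
    lexpect (p.map k) f = lexpect p fun x => f (k x) := by
  rw [← PMF.bind_pure_comp, lexpect_bind]
  simp [lexpect_pure]

lemma lexpect_mono {p : PMF α} {f g : α → ℝ≥0∞} (h : ∀ x, p x ≠ 0 → f x ≤ g x) :
    lexpect p f ≤ lexpect p g := by
  refine ENNReal.tsum_le_tsum fun x => ?_
  by_cases hx : p x = 0
  · simp [hx]
  · exact mul_le_mul_right (h x hx) _

lemma lexpect_congr {p : PMF α} {f g : α → ℝ≥0∞} (h : ∀ x, p x ≠ 0 → f x = g x) :
    lexpect p f = lexpect p g :=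
  le_antisymm (lexpect_mono fun x hx => (h x hx).le) (lexpect_mono fun x hx => (h x hx).ge)

lemma lexpect_const (p : PMF α) (c : ℝ≥0∞) : lexpect p (fun _ => c) = c := by
  simp [lexpect, ENNReal.tsum_mul_right]

lemma lexpect_add (p : PMF α) (f g : α → ℝ≥0∞) :
    lexpect p (fun x => f x + g x) = lexpect p f + lexpect p g := by
  simp [lexpect, mul_add, ENNReal.tsum_add]

lemma lexpect_const_mul (p : PMF α) (c : ℝ≥0∞) (f : α → ℝ≥0∞) :
    lexpect p (fun x => c * f x) = c * lexpect p f := by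
  simp [lexpect, mul_left_comm, ENNReal.tsum_mul_left]

lemma lexpect_mul_const (p : PMF α) (c : ℝ≥0∞) (f : α → ℝ≥0∞) :
    lexpect p (fun x => f x * c) = lexpect p f * c := by
  simp [lexpect, ← mul_assoc, ENNReal.tsum_mul_right]

lemma lexpect_sum {ι : Type*} (p : PMF α) (s : Finset ι) (f : ι → α → ℝ≥0∞) :
    lexpect p (fun x => ∑ i ∈ s, f i x) = ∑ i ∈ s, lexpect p (f i) := by
  classical
  induction s using Finset.induction_on with
  | empty => simp [lexpect]
  | insert i s hi ih => simp only [Finset.sum_insert hi, lexpect_add, ih]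

lemma lexpect_le {p : PMF α} {f : α → ℝ≥0∞} {c : ℝ≥0∞} (h : ∀ x, p x ≠ 0 → f x ≤ c) :
    lexpect p f ≤ c :=
  (lexpect_mono h).trans (lexpect_const p c).le

lemma lexpect_indep_prod : ∀ {n : ℕ} (p : Fin n → PMF α) (F : Fin n → α → ℝ≥0∞),
    lexpect (indep n p) (fun x => ∏ i, F i (x i)) = ∏ i, lexpect (p i) (F i)
  | 0, p, F => by simp [indep, lexpect_pure]
  | n + 1, p, F => by
    simp only [indep, lexpect_bind, lexpect_map, Fin.prod_univ_succ, Fin.cons_zero, Fin.cons_succ,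
      lexpect_const_mul, lexpect_mul_const,
      lexpect_indep_prod (fun i : Fin n => p i.succ) fun i => F i.succ]

lemma indep_support : ∀ {n : ℕ} (p : Fin n → PMF α) (x : Fin n → α),
    indep n p x ≠ 0 → ∀ i, p i (x i) ≠ 0
  | 0, _, _, _ => fun i => i.elim0
  | n + 1, p, x, h => by
    have h' : x ∈ (indep (n + 1) p).support := h
    simp only [indep, PMF.mem_support_bind_iff, PMF.mem_support_map_iff] at h'
    obtain ⟨a, ha, y, hy, rfl⟩ := h'
    refine Fin.cases ?_ fun i => ?_
    · simpa using ha
    · simpa using indep_support _ y hy i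

lemma toOuterMeasure_eq_lexpect (p : PMF α) (s : Set α) :
    p.toOuterMeasure s = lexpect p (s.indicator 1) := by
  rw [PMF.toOuterMeasure_apply]
  refine tsum_congr fun x => ?_
  by_cases hx : x ∈ s <;> simp [hx]

lemma ofReal_one_sub_le_toOuterMeasure {p : PMF α} {s : Set α} {δ : ℝ} (hδ : 0 ≤ δ)
    (h : lexpect p (sᶜ.indicator 1) ≤ ENNReal.ofReal δ) :
    ENNReal.ofReal (1 - δ) ≤ p.toOuterMeasure s := by
  have h1 : lexpect p (s.indicator 1) + lexpect p (sᶜ.indicator 1) = 1 := by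
    rw [← lexpect_add, ← lexpect_const p 1]
    congr 1
    ext x
    by_cases hx : x ∈ s <;> simp [hx]
  rw [toOuterMeasure_eq_lexpect, ENNReal.ofReal_sub _ hδ, ENNReal.ofReal_one, ← h1]
  exact tsub_le_iff_right.2 (add_le_add_right h _)

/-- Markov's inequality in exponential form, for the indicator of an event. -/
lemma indicator_le_sum_exp {ι : Type*} (s : Finset ι) (v : ι → ℝ) (K : ℝ) (hK : 0 < K) {q : Prop}
    [Decidable q] (h : q → ∃ i ∈ s, Real.log K < v i) :
    (if q then (1 : ℝ≥0∞) else 0) ≤ ∑ i ∈ s, ENNReal.ofReal (Real.exp (v i) / K) := by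
  split_ifs with hq
  · obtain ⟨i, hi, hv⟩ := h hq
    refine le_trans ?_ (Finset.single_le_sum (f := fun i => ENNReal.ofReal (Real.exp (v i) / K))
      (fun _ _ => zero_le) hi)
    rw [← ENNReal.ofReal_one]
    refine ENNReal.ofReal_le_ofReal ?_
    rw [le_div_iff₀ hK, one_mul, ← Real.log_le_iff_le_exp hK]
    exact hv.le
  · exact zero_le

end lexpect

/-! ### Real expectations of bounded functions -/

section expect

variable {α γ : Type*} {p : PMF α} {f g : α → ℝ} {b : ℝ}

lemma summable_toReal (p : PMF α) : Summable fun x => (p x).toReal :=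
  ENNReal.summable_toReal p.tsum_coe_ne_top

lemma tsum_toReal (p : PMF α) : ∑' x, (p x).toReal = 1 := by
  rw [← ENNReal.tsum_toReal_eq fun x => p.apply_ne_top x, p.tsum_coe, ENNReal.toReal_one]

lemma toReal_pos {x : α} (h : p x ≠ 0) : 0 < (p x).toReal :=
  ENNReal.toReal_pos h (p.apply_ne_top x)

lemma summable_expect (hf : ∀ x, p x ≠ 0 → |f x| ≤ b) :
    Summable fun x => (p x).toReal * f x := by
  refine Summable.of_norm_bounded (g := fun x => (p x).toReal * b)
    ((summable_toReal p).mul_right b) fun x => ?_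
  rw [Real.norm_eq_abs, abs_mul, abs_of_nonneg ENNReal.toReal_nonneg]
  by_cases hx : p x = 0
  · simp [hx]
  · exact mul_le_mul_of_nonneg_left (hf x hx) ENNReal.toReal_nonneg

lemma expect_congr (h : ∀ x, p x ≠ 0 → f x = g x) : expect p f = expect p g := by
  refine tsum_congr fun x => ?_
  by_cases hx : p x = 0
  · simp [hx]
  · rw [h x hx]

lemma expect_const (p : PMF α) (c : ℝ) : expect p (fun _ => c) = c := by
  rw [expect, tsum_mul_right, tsum_toReal, one_mul]

lemma expect_const_mul (p : PMF α) (c : ℝ) (f : α → ℝ) :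
    expect p (fun x => c * f x) = c * expect p f := by
  simp only [expect, mul_left_comm _ c, tsum_mul_left]

lemma expect_add {b' : ℝ} (hf : ∀ x, p x ≠ 0 → |f x| ≤ b) (hg : ∀ x, p x ≠ 0 → |g x| ≤ b') :
    expect p (fun x => f x + g x) = expect p f + expect p g := by
  simp only [expect, mul_add]
  exact (summable_expect hf).tsum_add (summable_expect hg)

lemma expect_sub {b' : ℝ} (hf : ∀ x, p x ≠ 0 → |f x| ≤ b) (hg : ∀ x, p x ≠ 0 → |g x| ≤ b') :
    expect p (fun x => f x - g x) = expect p f - expect p g := by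
  simp only [expect, mul_sub]
  exact (summable_expect hf).tsum_sub (summable_expect hg)

lemma expect_mono {b' : ℝ} (hf : ∀ x, p x ≠ 0 → |f x| ≤ b) (hg : ∀ x, p x ≠ 0 → |g x| ≤ b')
    (h : ∀ x, p x ≠ 0 → f x ≤ g x) : expect p f ≤ expect p g := by
  refine (summable_expect hf).tsum_le_tsum (fun x => ?_) (summable_expect hg)
  by_cases hx : p x = 0
  · simp [hx]
  · exact mul_le_mul_of_nonneg_left (h x hx) ENNReal.toReal_nonneg

lemma expect_nonneg (h : ∀ x, p x ≠ 0 → 0 ≤ f x) : 0 ≤ expect p f := by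
  refine tsum_nonneg fun x => ?_
  by_cases hx : p x = 0
  · simp [hx]
  · exact mul_nonneg ENNReal.toReal_nonneg (h x hx)

lemma expect_le (hf : ∀ x, p x ≠ 0 → |f x| ≤ b) {c : ℝ} (h : ∀ x, p x ≠ 0 → f x ≤ c) :
    expect p f ≤ c :=
  (expect_mono hf (fun _ _ => le_rfl) h).trans (expect_const p c).le

lemma le_expect (hf : ∀ x, p x ≠ 0 → |f x| ≤ b) {c : ℝ} (h : ∀ x, p x ≠ 0 → c ≤ f x) :
    c ≤ expect p f :=
  (expect_const p c).ge.trans (expect_mono (fun _ _ => le_rfl) hf h)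

lemma abs_expect_le (hf : ∀ x, p x ≠ 0 → |f x| ≤ b) : |expect p f| ≤ b :=
  abs_le.2 ⟨le_expect hf fun x hx => (abs_le.1 (hf x hx)).1,
    expect_le hf fun x hx => (abs_le.1 (hf x hx)).2⟩

lemma lexpect_ofReal (hf : ∀ x, p x ≠ 0 → |f x| ≤ b) (h : ∀ x, p x ≠ 0 → 0 ≤ f x) :
    lexpect p (fun x => ENNReal.ofReal (f x)) = ENNReal.ofReal (expect p f) := by
  rw [expect, ENNReal.ofReal_tsum_of_nonneg _ (summable_expect hf)]
  · refine tsum_congr fun x => ?_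
    rw [ENNReal.ofReal_mul ENNReal.toReal_nonneg, ENNReal.ofReal_toReal (p.apply_ne_top x)]
  · intro x
    by_cases hx : p x = 0
    · simp [hx]
    · exact mul_nonneg ENNReal.toReal_nonneg (h x hx)

/-- Shifting by the bound makes the function nonnegative, so that identities of extended nonnegative
expectations, which need no summability, carry over to bounded real functions. -/
lemma expect_eq_toReal_lexpect (hf : ∀ x, p x ≠ 0 → |f x| ≤ b) :
    expect p f = (lexpect p fun x => ENNReal.ofReal (f x + b)).toReal - b := by
  have hb : ∀ x, p x ≠ 0 → |f x + b| ≤ 2 * b := fun x hx => by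
    have := abs_le.1 (hf x hx)
    rw [abs_le]
    constructor <;> linarith
  have h0 : ∀ x, p x ≠ 0 → 0 ≤ f x + b := fun x hx => by
    linarith [(abs_le.1 (hf x hx)).1]
  rw [lexpect_ofReal hb h0, ENNReal.toReal_ofReal (expect_nonneg h0),
    expect_add hf fun _ _ => le_rfl, expect_const, add_sub_cancel_right]

lemma expect_map {k : α → γ} {f : γ → ℝ} (hf : ∀ x, p x ≠ 0 → |f (k x)| ≤ b) :
    expect (p.map k) f = expect p fun x => f (k x) := by
  rw [expect_eq_toReal_lexpect hf, ← lexpect_map p k fun y => ENNReal.ofReal (f y + b),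
    ← expect_eq_toReal_lexpect]
  intro y hy
  obtain ⟨x, hx, rfl⟩ := (PMF.mem_support_map_iff k p y).1 hy
  exact hf x hx

end expect

/-! ### Laws of trajectories and the tilted policy -/

namespace DCMDP

variable {S A : Type*} {H : ℕ} (M : DCMDP S A)

lemma stateAt_cons {n : ℕ} (s : S) (a : A) (as : Fin n → A) (h : ℕ) :
    M.stateAt s (Fin.cons a as : Fin (n + 1) → A) (h + 1) = M.stateAt (M.next s a) as h := by
  induction h with
  | zero => simp [stateAt]
  | succ k ih =>
    rw [stateAt, ih, stateAt]
    by_cases hk : k < n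
    · have h1 : (⟨k + 1, by omega⟩ : Fin (n + 1)) = Fin.succ ⟨k, hk⟩ := rfl
      rw [dif_pos (by omega), dif_pos hk, h1, Fin.cons_succ]
    · rw [dif_neg (by omega), dif_neg hk]

lemma rollout_cons {n : ℕ} (π : Fin (n + 1) → S → PMF A) (s : S) (a : A) (as : Fin n → A) :
    M.rollout (n + 1) π s (Fin.cons a as) =
      π 0 s a * M.rollout n (fun h => π h.succ) (M.next s a) as := by
  rw [rollout, PMF.bind_apply, tsum_eq_single a]
  · rw [PMF.map_apply, tsum_eq_single as]
    · simp
    · intro b hb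
      rw [if_neg]
      intro h
      exact hb (Fin.cons_right_injective (α := fun _ => A) a h).symm
  · intro b hb
    rw [PMF.map_apply]
    refine mul_eq_zero_of_right _ (ENNReal.tsum_eq_zero.2 fun x => if_neg fun h => hb ?_)
    simpa using (congrFun h 0).symm

lemma rollout_eq_prod : ∀ {n : ℕ} (π : Fin n → S → PMF A) (s : S) (a : Fin n → A),
    M.rollout n π s a = ∏ h : Fin n, π h (M.stateAt s a h) (a h)
  | 0, π, s, a => by
    rw [rollout, PMF.pure_apply, if_pos (Subsingleton.elim _ _)]
    simp
  | n + 1, π, s, a => by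
    obtain ⟨x, as, rfl⟩ : ∃ x as, a = Fin.cons (α := fun _ => A) x as :=
      ⟨a 0, Fin.tail a, (Fin.cons_self_tail a).symm⟩
    rw [rollout_cons, rollout_eq_prod, Fin.prod_univ_succ]
    simp [stateAt_cons, stateAt]

lemma toReal_sampler (π : Policy S A H) (s : S) (a : Fin H → A) :
    (M.sampler π s a).toReal = M.prob π (s, a) := by
  rw [sampler, rollout_eq_prod, ENNReal.toReal_prod, prob]

lemma prob_nonneg (π : Policy S A H) (τ : Traj S A H) : 0 ≤ M.prob π τ :=
  Finset.prod_nonneg fun _ _ => ENNReal.toReal_nonneg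

lemma sampler_eq_ofReal (π : Policy S A H) (s : S) (a : Fin H → A) :
    M.sampler π s a = ENNReal.ofReal (M.prob π (s, a)) := by
  rw [← toReal_sampler, ENNReal.ofReal_toReal (PMF.apply_ne_top _ _)]

lemma sampler_ne_zero_iff (π : Policy S A H) (s : S) (a : Fin H → A) :
    M.sampler π s a ≠ 0 ↔ M.prob π (s, a) ≠ 0 := by
  rw [sampler_eq_ofReal, Ne, ENNReal.ofReal_eq_zero, not_le]
  exact (M.prob_nonneg π (s, a)).lt_iff_ne'

lemma trajLaw_apply (p : Sampler S A H) (τ : Traj S A H) :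
    M.trajLaw p τ = M.init τ.1 * p τ.1 τ.2 := by
  obtain ⟨s, a⟩ := τ
  rw [trajLaw, PMF.bind_apply, tsum_eq_single s]
  · rw [PMF.map_apply, tsum_eq_single a]
    · simp
    · intro b hb
      rw [if_neg]
      simpa using hb.symm
  · intro s' hs
    rw [PMF.map_apply]
    refine mul_eq_zero_of_right _ (ENNReal.tsum_eq_zero.2 fun x => if_neg fun h => hs ?_)
    simpa using (congrArg Prod.fst h).symm

lemma trajLaw_support {p : Sampler S A H} {τ : Traj S A H} (h : M.trajLaw p τ ≠ 0) :
    M.init τ.1 ≠ 0 ∧ p τ.1 τ.2 ≠ 0 := by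
  rw [trajLaw_apply] at h
  exact ⟨left_ne_zero_of_mul h, right_ne_zero_of_mul h⟩

lemma pairLaw_support {p q : Sampler S A H} {x : S × (Fin H → A) × (Fin H → A)}
    (h : M.pairLaw p q x ≠ 0) : M.init x.1 ≠ 0 ∧ p x.1 x.2.1 ≠ 0 ∧ q x.1 x.2.2 ≠ 0 := by
  have h' : x ∈ (M.pairLaw p q).support := h
  simp only [pairLaw, PMF.mem_support_bind_iff, PMF.mem_support_map_iff] at h'
  obtain ⟨s, hs, a, ha, b, hb, rfl⟩ := h'
  exact ⟨hs, ha, hb⟩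

lemma map_fun_const {α γ : Type*} (p : PMF α) (c : γ) : p.map (fun _ => c) = PMF.pure c :=
  PMF.map_const p c

lemma pairLaw_map_left (p q : Sampler S A H) :
    (M.pairLaw p q).map (fun x => (x.1, x.2.1)) = M.trajLaw p := by
  simp only [pairLaw, trajLaw, PMF.map_bind, PMF.map_comp, Function.comp_def, map_fun_const]
  rfl

lemma pairLaw_map_right (p q : Sampler S A H) :
    (M.pairLaw p q).map (fun x => (x.1, x.2.2)) = M.trajLaw q := by
  simp only [pairLaw, trajLaw, PMF.map_bind, PMF.map_comp, Function.comp_def, PMF.bind_const]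

lemma trajLaw_map_fst (p : Sampler S A H) : (M.trajLaw p).map Prod.fst = M.init := by
  simp only [trajLaw, PMF.map_bind, PMF.map_comp, Function.comp_def, map_fun_const, PMF.bind_pure]

lemma lexpect_label (x : S × (Fin H → A) × (Fin H → A))
    (F : Traj S A H × Traj S A H → ℝ≥0∞) :
    lexpect (M.label x) F =
      ENNReal.ofReal (M.prefProb (x.1, x.2.1) (x.1, x.2.2)) * F ((x.1, x.2.1), (x.1, x.2.2)) +
      ENNReal.ofReal (M.prefProb (x.1, x.2.2) (x.1, x.2.1)) * F ((x.1, x.2.2), (x.1, x.2.1)) := by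
  rw [label, lexpect_map, lexpect, tsum_fintype, Fintype.sum_bool]
  simp

lemma prefProb_eq_sigmoid (τ τ' : Traj S A H) :
    M.prefProb τ τ' = Real.sigmoid (M.totalReward τ - M.totalReward τ') := by
  rw [prefProb, Real.sigmoid_def, neg_sub, Real.exp_sub]
  have := Real.exp_pos (M.totalReward τ)
  field_simp

/-- The exponentiated reward `exp (r(s, a) / β)`. -/
def stepWeight (β : ℝ) (s : S) (a : A) : ℝ≥0∞ := ENNReal.ofReal (Real.exp (M.reward s a / β))

lemma stepWeight_ne_zero (β : ℝ) (s : S) (a : A) : M.stepWeight β s a ≠ 0 := by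
  simp [stepWeight, Real.exp_pos]

/-- The partition function `E_π[exp (r(τ) / β) | s]` of the remaining `n` steps. -/
def partition (β : ℝ) : (n : ℕ) → (Fin n → S → PMF A) → S → ℝ≥0∞
  | 0, _, _ => 1
  | n + 1, π, s => lexpect (π 0 s) fun a =>
      M.stepWeight β s a * partition β n (fun h => π h.succ) (M.next s a)

lemma partition_ne_zero (β : ℝ) :
    ∀ (n : ℕ) (π : Fin n → S → PMF A) (s : S), M.partition β n π s ≠ 0
  | 0, _, _ => one_ne_zero
  | n + 1, π, s => by
    obtain ⟨a, ha⟩ := (π 0 s).support_nonempty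
    intro h
    exact mul_ne_zero ha (mul_ne_zero (M.stepWeight_ne_zero β s a)
      (partition_ne_zero β n _ _)) (ENNReal.tsum_eq_zero.1 h a)

/-- The policy `∝ π · exp (r / β)` on trajectories (where the partition function is finite). -/
def tilt (β : ℝ) : (n : ℕ) → (Fin n → S → PMF A) → Fin n → S → PMF A
  | 0, π => π
  | n + 1, π => Fin.cons
      (fun s =>
        open Classical in
        if h : M.partition β (n + 1) π s = ⊤ then π 0 s
        else PMF.normalize (fun a => π 0 s a *
          (M.stepWeight β s a * M.partition β n (fun h => π h.succ) (M.next s a)))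
          (M.partition_ne_zero β (n + 1) π s) h)
      (tilt β n fun h => π h.succ)

/-- At each step the normalizer of the tilt is the partition function at the current state and the
weight contains the one at the next state, so the product telescopes. This uses that transitions are
deterministic. Finiteness at `s` passes to all successors of positive probability, so the fallback
branch of `tilt` is never met on relevant trajectories. -/
lemma rollout_tilt (β : ℝ) : ∀ {n : ℕ} (π : Fin n → S → PMF A) (s : S) (a : Fin n → A),
    M.partition β n π s ≠ ⊤ →
    M.rollout n (M.tilt β n π) s a * M.partition β n π s =
      M.rollout n π s a * ∏ h : Fin n, M.stepWeight β (M.stateAt s a h) (a h)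
  | 0, π, s, a, _ => by simp [tilt, partition]
  | n + 1, π, s, a, hZ => by
    obtain ⟨x, as, rfl⟩ : ∃ x as, a = Fin.cons (α := fun _ => A) x as :=
      ⟨a 0, Fin.tail a, (Fin.cons_self_tail a).symm⟩
    have hZ0 := M.partition_ne_zero β (n + 1) π s
    rw [rollout_cons, rollout_cons, Fin.prod_univ_succ]
    simp only [Fin.val_succ, stateAt_cons, Fin.cons_succ, Fin.cons_zero, Fin.val_zero]
    have h1 : M.tilt β (n + 1) π 0 s x * M.partition β (n + 1) π s = π 0 s x *
        (M.stepWeight β s x * M.partition β n (fun h => π h.succ) (M.next s x)) := by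
      simp only [tilt, Fin.cons_zero, dif_neg hZ]
      erw [PMF.normalize_apply]
      rw [mul_assoc, show (∑' a, π 0 s a * (M.stepWeight β s a *
        M.partition β n (fun h => π h.succ) (M.next s a))) = M.partition β (n + 1) π s from rfl,
        ENNReal.inv_mul_cancel hZ0 hZ, mul_one]
    have h2 : (fun h : Fin n => M.tilt β (n + 1) π h.succ) = M.tilt β n fun h => π h.succ := by
      funext h
      simp [tilt]
    have h0 : M.stateAt s (Fin.cons x as : Fin (n + 1) → A) 0 = s := rfl
    rw [h2, h0, mul_right_comm, h1]
    by_cases hx : π 0 s x = 0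
    · simp [hx]
    · have hn : M.partition β n (fun h => π h.succ) (M.next s x) ≠ ⊤ := by
        intro htop
        refine hZ (ENNReal.tsum_eq_top_of_eq_top ⟨x, ?_⟩)
        simp only [htop]
        rw [ENNReal.mul_top (M.stepWeight_ne_zero β s x), ENNReal.mul_top hx]
      have ih := rollout_tilt β (fun h => π h.succ) (M.next s x) as hn
      calc _ = π 0 s x * M.stepWeight β s x * (M.rollout n (M.tilt β n fun h => π h.succ)
              (M.next s x) as * M.partition β n (fun h => π h.succ) (M.next s x)) := by ring
        _ = _ := by rw [ih]; ring

lemma prod_stepWeight (β : ℝ) (s : S) (a : Fin H → A) :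
    ∏ h : Fin H, M.stepWeight β (M.stateAt s a h) (a h) =
      ENNReal.ofReal (Real.exp (M.totalReward (s, a) / β)) := by
  rw [totalReward, Finset.sum_div, Real.exp_sum, ENNReal.ofReal_prod_of_nonneg]
  · rfl
  · exact fun _ _ => (Real.exp_pos _).le

lemma partition_eq_lexpect (β : ℝ) : ∀ {n : ℕ} (π : Fin n → S → PMF A) (s : S),
    M.partition β n π s = lexpect (M.rollout n π s) fun a =>
      ∏ h : Fin n, M.stepWeight β (M.stateAt s a h) (a h)
  | 0, π, s => by simp [partition, rollout, lexpect_pure]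
  | n + 1, π, s => by
    have h0 : ∀ a : Fin (n + 1) → A, M.stateAt s a 0 = s := fun _ => rfl
    simp only [partition, rollout, lexpect_bind, lexpect_map, Fin.prod_univ_succ, Fin.val_succ,
      stateAt_cons, Fin.cons_succ, Fin.cons_zero, Fin.val_zero, h0, lexpect_const_mul,
      partition_eq_lexpect β fun h : Fin n => π h.succ]

end DCMDP

/-! ### The closed form of the optimal policy -/

namespace Problem

variable {S A : Type*} {H N : ℕ} (P : Problem S A H N)

variable {P} in
lemma sampler_ref_ne_zero {V : ℝ} (hV : P.RatioBounded V) {π : Policy S A H} (hπ : π ∈ P.cls)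
    {s : S} {a : Fin H → A} (h : P.mdp.sampler π s a ≠ 0) : P.mdp.prob P.ref (s, a) ≠ 0 := by
  rw [DCMDP.sampler_ne_zero_iff] at h
  exact fun h0 => h ((hV π hπ _).1.2 h0)

/-- The normalizing constant of the optimal policy, on the logarithmic scale. -/
def softValue (s : S) : ℝ := P.β * Real.log (P.mdp.partition P.β H P.ref s).toReal

section optimal

variable {P} {R : ℝ}

lemma partition_mem_Icc (hβ : 0 < P.β) (hR : P.RewardBounded R) (s : S) :
    1 ≤ P.mdp.partition P.β H P.ref s ∧
      P.mdp.partition P.β H P.ref s ≤ ENNReal.ofReal (Real.exp (R / P.β)) := by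
  rw [DCMDP.partition_eq_lexpect]
  simp only [DCMDP.prod_stepWeight]
  constructor
  · rw [← lexpect_const (P.mdp.rollout H P.ref s) 1]
    refine lexpect_mono fun a _ => ?_
    rw [← ENNReal.ofReal_one]
    exact ENNReal.ofReal_le_ofReal (Real.one_le_exp (div_nonneg (hR _).1 hβ.le))
  · refine lexpect_le fun a _ => ENNReal.ofReal_le_ofReal (Real.exp_le_exp.2 ?_)
    exact div_le_div_of_nonneg_right (hR _).2 hβ.le

lemma partition_ne_top (hβ : 0 < P.β) (hR : P.RewardBounded R) (s : S) :
    P.mdp.partition P.β H P.ref s ≠ ⊤ :=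
  ne_top_of_le_ne_top ENNReal.ofReal_ne_top (partition_mem_Icc hβ hR s).2

lemma exp_softValue (hβ : 0 < P.β) (hR : P.RewardBounded R) (s : S) :
    Real.exp (P.softValue s / P.β) = (P.mdp.partition P.β H P.ref s).toReal := by
  rw [softValue, mul_div_cancel_left₀ _ hβ.ne', Real.exp_log]
  exact ENNReal.toReal_pos (DCMDP.partition_ne_zero _ _ _ _ _) (partition_ne_top hβ hR s)

lemma softValue_mem_Icc (hβ : 0 < P.β) (hR : P.RewardBounded R) (s : S) :
    0 ≤ P.softValue s ∧ P.softValue s ≤ R := by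
  have h := partition_mem_Icc hβ hR s
  rw [← ENNReal.ofReal_toReal (partition_ne_top hβ hR s), ← exp_softValue hβ hR s,
    ENNReal.one_le_ofReal, ENNReal.ofReal_le_ofReal_iff (Real.exp_pos _).le, Real.exp_le_exp,
    Real.one_le_exp_iff, div_le_div_iff_of_pos_right hβ] at h
  exact ⟨by simpa using (le_div_iff₀ hβ).1 h.1, h.2⟩

lemma prob_tilt (hβ : 0 < P.β) (hR : P.RewardBounded R) (τ : Traj S A H) :
    P.mdp.prob (P.mdp.tilt P.β H P.ref) τ =
      P.mdp.prob P.ref τ * Real.exp ((P.mdp.totalReward τ - P.softValue τ.1) / P.β) := by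
  obtain ⟨s, a⟩ := τ
  have h := P.mdp.rollout_tilt P.β P.ref s a (partition_ne_top hβ hR s)
  rw [DCMDP.prod_stepWeight] at h
  have h' := congrArg ENNReal.toReal h
  rw [ENNReal.toReal_mul, ENNReal.toReal_mul, ENNReal.toReal_ofReal (Real.exp_pos _).le,
    ← exp_softValue hβ hR s] at h'
  have e1 : (P.mdp.rollout H (P.mdp.tilt P.β H P.ref) s a).toReal =
    P.mdp.prob (P.mdp.tilt P.β H P.ref) (s, a) := P.mdp.toReal_sampler _ s a
  have e2 : (P.mdp.rollout H P.ref s a).toReal = P.mdp.prob P.ref (s, a) :=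
    P.mdp.toReal_sampler _ s a
  rw [e1, e2] at h'
  rw [sub_div, Real.exp_sub, ← mul_div_assoc, ← h', mul_div_cancel_right₀ _ (Real.exp_pos _).ne']

lemma logRatio_tilt (hβ : 0 < P.β) (hR : P.RewardBounded R) {τ : Traj S A H}
    (hτ : P.mdp.prob P.ref τ ≠ 0) :
    P.β * P.logRatio (P.mdp.tilt P.β H P.ref) τ = P.mdp.totalReward τ - P.softValue τ.1 := by
  rw [logRatio, prob_tilt hβ hR, mul_div_cancel_left₀ _ hτ, Real.log_exp,
    mul_div_cancel₀ _ hβ.ne']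

lemma sampler_tilt_support (hβ : 0 < P.β) (hR : P.RewardBounded R) {τ : Traj S A H}
    (h : P.mdp.trajLaw (P.mdp.sampler (P.mdp.tilt P.β H P.ref)) τ ≠ 0) :
    P.mdp.prob P.ref τ ≠ 0 := by
  have h1 := (P.mdp.trajLaw_support h).2
  rw [DCMDP.sampler_ne_zero_iff, prob_tilt hβ hR] at h1
  exact left_ne_zero_of_mul h1

lemma finiteKL_tilt (hβ : 0 < P.β) (hR : P.RewardBounded R) :
    P.FiniteKL (P.mdp.tilt P.β H P.ref) := by
  refine ⟨fun τ _ h => by rw [prob_tilt hβ hR, h, zero_mul], ?_⟩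
  refine summable_expect (b := R / P.β) fun τ h => ?_
  have h1 := logRatio_tilt hβ hR (sampler_tilt_support hβ hR h)
  have h2 := softValue_mem_Icc hβ hR τ.1
  have h3 := hR τ
  rw [eq_div_of_mul_eq hβ.ne' ((mul_comm _ _).trans h1), abs_div, abs_of_pos hβ]
  refine div_le_div_of_nonneg_right (abs_le.2 ⟨?_, ?_⟩) hβ.le <;> linarith

lemma J_tilt (hβ : 0 < P.β) (hR : P.RewardBounded R) :
    P.J (P.mdp.tilt P.β H P.ref) = expect P.mdp.init P.softValue := by
  rw [← P.mdp.trajLaw_map_fst (P.mdp.sampler (P.mdp.tilt P.β H P.ref)), expect_map (b := R), J]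
  · refine expect_congr fun τ h => ?_
    rw [logRatio_tilt hβ hR (sampler_tilt_support hβ hR h)]
    ring
  · intro τ _
    have h2 := softValue_mem_Icc hβ hR τ.1
    rw [abs_of_nonneg h2.1]
    exact h2.2

variable {V : ℝ} {πstar : Policy S A H}

/-- The optimal policy is proportional to `π_ref · exp (r / β)` for each initial state. -/
lemma optimal_logRatio (hβ : 0 < P.β) (hR : P.RewardBounded R) (hV : P.RatioBounded V)
    (hopt : P.IsOptimal πstar) (hmem : πstar ∈ P.cls) {τ : Traj S A H}
    (hτ : P.mdp.init τ.1 ≠ 0) (href : P.mdp.prob P.ref τ ≠ 0) :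
    P.β * P.logRatio πstar τ = P.mdp.totalReward τ - P.softValue τ.1 := by
  -- The equality case of Gibbs' inequality. Here `x` is the log-density of the tilted law with
  -- respect to the law `p` of `πstar`, so E exp(x) = 1, while optimality against the tilted policy
  -- gives E x ≥ 0. Hence the nonnegative function exp(x) − 1 − x has mean at most 0 and vanishes
  -- wherever `p` is positive, which forces x = 0 there.
  set p := P.mdp.trajLaw (P.mdp.sampler πstar) with hp
  set F : Traj S A H → ℝ := fun τ => P.mdp.totalReward τ - P.β * P.logRatio πstar τ with hF
  set x : Traj S A H → ℝ := fun τ => (F τ - P.softValue τ.1) / P.β with hx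
  have hFb : ∀ τ, |F τ| ≤ R + V := fun τ => by
    have h1 := hR τ
    have h2 := abs_le.1 ((hV πstar hmem τ).2)
    have h3 : |P.β * P.logRatio πstar τ| ≤ V := by
      rw [abs_mul, abs_of_pos hβ, ← le_div_iff₀' hβ]
      exact (hV πstar hmem τ).2
    have h4 := abs_le.1 h3
    simp only [hF]
    rw [abs_le]
    constructor <;> linarith
  have hcb : ∀ τ : Traj S A H, |P.softValue τ.1| ≤ R := fun τ => by
    have h2 := softValue_mem_Icc hβ hR τ.1
    rw [abs_of_nonneg h2.1]
    exact h2.2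
  have hxb : ∀ τ, |x τ| ≤ (R + V + R) / P.β := fun τ => by
    simp only [hx]
    rw [abs_div, abs_of_pos hβ]
    exact div_le_div_of_nonneg_right ((abs_sub _ _).trans (add_le_add (hFb τ) (hcb τ))) hβ.le
  have hpos : ∀ τ, p τ ≠ 0 → P.mdp.prob πstar τ ≠ 0 := fun τ h =>
    (DCMDP.sampler_ne_zero_iff _ _ _ _).1 (P.mdp.trajLaw_support h).2
  -- the density of the tilted policy
  have hdens : ∀ τ, P.mdp.prob πstar τ * Real.exp (x τ) =
      P.mdp.prob (P.mdp.tilt P.β H P.ref) τ := fun τ => by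
    rw [prob_tilt hβ hR]
    by_cases h0 : P.mdp.prob P.ref τ = 0
    · rw [h0, (hV πstar hmem τ).1.2 h0]
      simp
    · have h1 : P.mdp.prob πstar τ ≠ 0 := fun h => h0 ((hV πstar hmem τ).1.1 h)
      have e : x τ = (P.mdp.totalReward τ - P.softValue τ.1) / P.β - P.logRatio πstar τ := by
        simp only [hx, hF]
        field_simp
        ring
      have h2 : 0 < P.mdp.prob πstar τ / P.mdp.prob P.ref τ :=
        div_pos ((P.mdp.prob_nonneg _ _).lt_of_ne' h1) ((P.mdp.prob_nonneg _ _).lt_of_ne' h0)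
      rw [e, Real.exp_sub, logRatio, Real.exp_log h2]
      field_simp
  have hexp : expect p (fun τ => Real.exp (x τ)) = 1 := by
    rw [← tsum_toReal (P.mdp.trajLaw (P.mdp.sampler (P.mdp.tilt P.β H P.ref)))]
    refine tsum_congr fun τ => ?_
    rw [hp, DCMDP.trajLaw_apply, DCMDP.trajLaw_apply, ENNReal.toReal_mul, ENNReal.toReal_mul,
      DCMDP.toReal_sampler, DCMDP.toReal_sampler, mul_assoc, hdens]
  have hEx : 0 ≤ expect p x := by
    have h1 := hopt.2 _ (finiteKL_tilt hβ hR)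
    rw [J_tilt hβ hR, ← P.mdp.trajLaw_map_fst (P.mdp.sampler πstar),
      expect_map (b := R) fun τ _ => hcb τ] at h1
    have h2 : expect p x = P.β⁻¹ * (expect p F - expect p fun τ => P.softValue τ.1) := by
      rw [← expect_sub (fun τ _ => hFb τ) (fun τ _ => hcb τ), ← expect_const_mul]
      refine expect_congr fun τ _ => ?_
      simp only [hx]
      ring
    rw [h2]
    exact mul_nonneg (inv_nonneg.2 hβ.le) (sub_nonneg.2 h1)
  have hexpb : ∀ τ, |Real.exp (x τ)| ≤ Real.exp ((R + V + R) / P.β) := fun τ => by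
    rw [abs_of_pos (Real.exp_pos _)]
    exact Real.exp_le_exp.2 ((le_abs_self _).trans (hxb τ))
  have hy : expect p (fun τ => Real.exp (x τ) - (x τ + 1)) ≤ 0 := by
    rw [expect_sub (b' := (R + V + R) / P.β + 1) (fun τ _ => hexpb τ)
      (fun τ _ => (abs_add_le _ _).trans (add_le_add (hxb τ) (by simp))),
      expect_add (b' := 1) (fun τ _ => hxb τ) (fun τ _ => by simp), hexp, expect_const]
    linarith
  have hnn : ∀ τ, 0 ≤ (p τ).toReal * (Real.exp (x τ) - (x τ + 1)) := fun τ =>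
    mul_nonneg ENNReal.toReal_nonneg (sub_nonneg.2 (Real.add_one_le_exp _))
  have hs : Summable fun τ => (p τ).toReal * (Real.exp (x τ) - (x τ + 1)) :=
    summable_expect (b := Real.exp ((R + V + R) / P.β) + ((R + V + R) / P.β + 1)) fun τ _ =>
      (abs_sub _ _).trans (add_le_add (hexpb τ)
        ((abs_add_le _ _).trans (add_le_add (hxb τ) (by simp))))
  have hz : (p τ).toReal * (Real.exp (x τ) - (x τ + 1)) = 0 :=
    le_antisymm ((hs.le_tsum τ fun τ _ => hnn τ).trans hy) (hnn τ)
  have hpτ : (p τ).toReal ≠ 0 := by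
    rw [hp, DCMDP.trajLaw_apply, ENNReal.toReal_mul, DCMDP.toReal_sampler]
    exact mul_ne_zero (toReal_pos hτ).ne' fun h => href ((hV πstar hmem τ).1.1 h)
  have hx0 : x τ = 0 := by
    by_contra hne
    have := Real.add_one_lt_exp hne
    have h0 := (mul_eq_zero.1 hz).resolve_left hpτ
    linarith
  have h5 : F τ - P.softValue τ.1 = 0 := by
    simpa [hx, hβ.ne'] using hx0
  simp only [hF] at h5
  linarith

end optimal

end Problem

/-! ### Bernoulli labels: Hellinger distance, tempered likelihood ratios, Hoeffding's lemma -/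

open Real (sigmoid exp log)

/-- The squared Hellinger distance of the Bernoulli distributions with log-odds `a` and `b`. -/
def hell (a b : ℝ) : ℝ := 1 - (√(sigmoid a * sigmoid b) + √(sigmoid (-a) * sigmoid (-b)))

/-- The log-likelihood ratio of an outcome with log-odds `a` against log-odds `b`. -/
def llr (a b : ℝ) : ℝ := log (sigmoid a) - log (sigmoid b)

lemma sigmoid_mul_exp_half (a b : ℝ) : sigmoid b * exp (llr a b / 2) = √(sigmoid a * sigmoid b) := by
  have ha := Real.sigmoid_pos a
  have hb := Real.sigmoid_pos b
  symm
  rw [Real.sqrt_eq_iff_mul_self_eq (by positivity) (by positivity)]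
  have h : exp (llr a b / 2) * exp (llr a b / 2) = sigmoid a / sigmoid b := by
    rw [← Real.exp_add, add_halves, llr, Real.exp_sub, Real.exp_log ha, Real.exp_log hb]
  rw [mul_mul_mul_comm, h]
  field_simp

lemma sigmoid_exp_half_add (a b : ℝ) :
    sigmoid b * exp (llr a b / 2) + sigmoid (-b) * exp (llr (-a) (-b) / 2) = 1 - hell a b := by
  rw [sigmoid_mul_exp_half, sigmoid_mul_exp_half, hell]
  ring

/-- Since √p + √q ≤ 2 on [0, 1], (p − q)² ≤ 4(√p − √q)². Adding this over the two outcomes gives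
twice the claim. -/
lemma sub_sq_le_four_mul_hell (a b : ℝ) : (sigmoid a - sigmoid b) ^ 2 ≤ 4 * hell a b := by
  have key : ∀ p q : ℝ, 0 ≤ p → 0 ≤ q → p ≤ 1 → q ≤ 1 → (p - q) ^ 2 ≤ 4 * (p + q - 2 * √(p * q)) := by
    intro p q hp hq hp1 hq1
    rw [Real.sqrt_mul hp]
    have e1 := Real.sq_sqrt hp
    have e2 := Real.sq_sqrt hq
    have l1 : √p ≤ 1 := Real.sqrt_le_one.2 hp1
    have l2 : √q ≤ 1 := Real.sqrt_le_one.2 hq1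
    have n1 := Real.sqrt_nonneg p
    have n2 := Real.sqrt_nonneg q
    have e3 : p - q = (√p - √q) * (√p + √q) := by nlinarith
    have e4 : p + q - 2 * (√p * √q) = (√p - √q) ^ 2 := by nlinarith
    rw [e3, e4, mul_pow, mul_comm]
    refine mul_le_mul_of_nonneg_right ?_ (sq_nonneg _)
    nlinarith
  have h1 := key _ _ (Real.sigmoid_nonneg a) (Real.sigmoid_nonneg b) (Real.sigmoid_le_one a)
    (Real.sigmoid_le_one b)
  have h2 := key _ _ (Real.sigmoid_nonneg (-a)) (Real.sigmoid_nonneg (-b))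
    (Real.sigmoid_le_one (-a)) (Real.sigmoid_le_one (-b))
  have h3 : (sigmoid (-a) - sigmoid (-b)) ^ 2 = (sigmoid a - sigmoid b) ^ 2 := by
    rw [Real.sigmoid_neg, Real.sigmoid_neg]
    ring
  have h4 := Real.sigmoid_neg a
  have h5 := Real.sigmoid_neg b
  rw [hell]
  linarith

lemma hell_nonneg (a b : ℝ) : 0 ≤ hell a b := by
  linarith [sub_sq_le_four_mul_hell a b, sq_nonneg (sigmoid a - sigmoid b)]

lemma hell_le_one (a b : ℝ) : hell a b ≤ 1 := by
  rw [hell]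
  linarith [Real.sqrt_nonneg (sigmoid a * sigmoid b), Real.sqrt_nonneg (sigmoid (-a) * sigmoid (-b))]

lemma abs_hell_le_one (a b : ℝ) : |hell a b| ≤ 1 := by
  rw [abs_of_nonneg (hell_nonneg a b)]
  exact hell_le_one a b

/-- The increment is E(1 − G)/((1 + EG)(1 + E)) with E = e^{−b}, G = e^{−g}. The denominator is at
most 4 e^R E because E lies in [e^{−R}, e^R], and 1 − e^{−g} ≥ g/(1 + g). Only the true log-odds `b`
need the bound `R`; the other argument costs just a factor 1 + g, so no exponential of V appears. -/
lemma le_sigmoid_add_sub {b g R : ℝ} (hb : |b| ≤ R) (hg : 0 ≤ g) :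
    g ≤ 4 * exp R * (1 + g) * (sigmoid (b + g) - sigmoid b) := by
  set E := exp (-b) with hE
  set G := exp (-g) with hG
  have hEp : 0 < E := Real.exp_pos _
  have hGp : 0 < G := Real.exp_pos _
  have hG1 : G ≤ 1 := Real.exp_le_one_iff.2 (by linarith)
  have hE1 : 1 ≤ exp R * E := by
    rw [hE, ← Real.exp_add]
    exact Real.one_le_exp (by linarith [(abs_le.1 hb).2])
  have hE2 : E ≤ exp R := Real.exp_le_exp.2 (by linarith [(abs_le.1 hb).1])
  have hR1 : 1 ≤ exp R := Real.one_le_exp ((abs_nonneg b).trans hb)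
  have hGg : g ≤ (1 + g) * (1 - G) := by
    have h1 : G * (1 + g) ≤ 1 := by
      have := Real.add_one_le_exp g
      calc G * (1 + g) ≤ G * exp g := by gcongr; linarith
        _ = 1 := by rw [hG, ← Real.exp_add]; simp
    nlinarith
  have e : sigmoid (b + g) - sigmoid b = E * (1 - G) / ((1 + E * G) * (1 + E)) := by
    rw [Real.sigmoid_def, Real.sigmoid_def, neg_add, Real.exp_add, ← hE, ← hG]
    field_simp
    ring
  have h4 : (1 + E * G) * (1 + E) ≤ 4 * exp R * E := by
    have : E * G ≤ E := mul_le_of_le_one_right hEp.le hG1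
    calc (1 + E * G) * (1 + E) ≤ (1 + E) * (1 + E) := by gcongr
      _ ≤ 4 * exp R * E := by nlinarith
  rw [e]
  calc g ≤ (1 + g) * (1 - G) := hGg
    _ = (1 + g) * (1 - G) * 1 := (mul_one _).symm
    _ ≤ (1 + g) * (1 - G) * (4 * exp R * E / ((1 + E * G) * (1 + E))) := by
        refine mul_le_mul_of_nonneg_left ?_ (mul_nonneg (by linarith) (by linarith))
        rwa [one_le_div (by positivity)]
    _ = _ := by ring

lemma abs_sub_le_sigmoid {a b R : ℝ} (hb : |b| ≤ R) :
    |a - b| ≤ 4 * exp R * (1 + |a - b|) * |sigmoid a - sigmoid b| := by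
  rcases le_total b a with h | h
  · have := le_sigmoid_add_sub hb (sub_nonneg.2 h)
    rw [add_sub_cancel] at this
    rwa [abs_of_nonneg (sub_nonneg.2 h), abs_of_nonneg (sub_nonneg.2 (Real.sigmoid_monotone h))]
  · have := le_sigmoid_add_sub (b := -b) (g := b - a) (R := R) (by rwa [abs_neg]) (sub_nonneg.2 h)
    rw [show -b + (b - a) = -a by ring, Real.sigmoid_neg, Real.sigmoid_neg,
      sub_sub_sub_cancel_left] at this
    rwa [abs_sub_comm a b, abs_sub_comm (sigmoid a), abs_of_nonneg (sub_nonneg.2 h),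
      abs_of_nonneg (sub_nonneg.2 (Real.sigmoid_monotone h))]

lemma sub_sq_le_hell {a b R G : ℝ} (hb : |b| ≤ R) (hG : |a - b| ≤ G) :
    (a - b) ^ 2 ≤ 64 * exp R ^ 2 * (1 + G) ^ 2 * hell a b := by
  have h1 := abs_sub_le_sigmoid (a := a) hb
  have h2 := sub_sq_le_four_mul_hell a b
  calc (a - b) ^ 2 = |a - b| ^ 2 := (sq_abs _).symm
    _ ≤ (4 * exp R * (1 + G) * |sigmoid a - sigmoid b|) ^ 2 := by
        refine pow_le_pow_left₀ (abs_nonneg _) (h1.trans ?_) 2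
        gcongr
    _ = 16 * exp R ^ 2 * (1 + G) ^ 2 * (sigmoid a - sigmoid b) ^ 2 := by
        rw [mul_pow, sq_abs]
        ring
    _ ≤ 16 * exp R ^ 2 * (1 + G) ^ 2 * (4 * hell a b) := by gcongr
    _ = _ := by ring

lemma llr_le {a b R : ℝ} (hb : |b| ≤ R) : llr a b ≤ 1 + R := by
  have h1 : log (sigmoid a) ≤ 0 := Real.log_nonpos (Real.sigmoid_nonneg a) (Real.sigmoid_le_one a)
  have h2 : -log (sigmoid b) ≤ 1 + R := by
    rw [Real.sigmoid_def, Real.log_inv, neg_neg, Real.log_le_iff_le_exp (by positivity)]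
    have h3 : exp (-b) ≤ exp R := Real.exp_le_exp.2 (by linarith [(abs_le.1 hb).1])
    have h4 : 1 ≤ exp R := Real.one_le_exp ((abs_nonneg b).trans hb)
    have h5 : 2 ≤ exp 1 := by linarith [Real.add_one_le_exp 1]
    rw [Real.exp_add]
    nlinarith
  rw [llr]
  linarith

lemma exp_le_one_add_add_sq {x : ℝ} (hx : x ≤ 1) : exp x ≤ 1 + x + x ^ 2 := by
  rcases le_or_gt (-1) x with h | h
  · have h1 := Real.abs_exp_sub_one_sub_id_le (abs_le.2 ⟨h, hx⟩)
    linarith [(abs_le.1 h1).2]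
  · have h1 : exp x ≤ 1 := Real.exp_le_one_iff.2 (by linarith)
    nlinarith

/-- With v = exp(s z) and y = (v − 1)/(2B) ≤ 1, exp(y) ≤ 1 + y + y², and B ≥ 1 bounds y + y² by (v²
− 1)/(4B). Bernoulli's inequality with exponent 1/(4s) ≥ 1 then compares v² with exp(z/2) =
(v²)^{1/(4s)}; this is where s ≤ 1/4 enters. -/
lemma exp_tempered_le {s B z : ℝ} (hs : 0 < s) (hs4 : s ≤ 1 / 4) (hB : 1 ≤ B)
    (hz : exp (s * z) ≤ B) :
    exp ((exp (s * z) - 1) / (2 * B)) ≤ 1 + s / B * (exp (z / 2) - 1) := by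
  have hBp : 0 < B := by linarith
  set v := exp (s * z) with hv
  have hvp : 0 < v := Real.exp_pos _
  have h1 : 1 + 1 / (4 * s) * (v ^ 2 - 1) ≤ exp (z / 2) := by
    have := one_add_mul_self_le_rpow_one_add (s := v ^ 2 - 1) (by nlinarith) (p := 1 / (4 * s))
      (by rw [le_div_iff₀ (by positivity)]; linarith)
    rw [add_sub_cancel] at this
    refine this.trans (le_of_eq ?_)
    rw [hv, ← Real.exp_nat_mul, ← Real.exp_mul]
    congr 1
    field_simp
    norm_num
    ring
  have h2 : (v ^ 2 - 1) / (4 * B) ≤ s / B * (exp (z / 2) - 1) := by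
    calc (v ^ 2 - 1) / (4 * B) = s / B * (1 / (4 * s) * (v ^ 2 - 1)) := by field_simp
      _ ≤ _ := by gcongr; linarith
  have h3 : (v - 1) / (2 * B) ≤ 1 := by
    rw [div_le_one (by positivity)]
    linarith
  have h4 := exp_le_one_add_add_sq h3
  have h5 : ((v - 1) / (2 * B)) ^ 2 ≤ (v - 1) ^ 2 / (4 * B) := by
    rw [div_pow]
    exact div_le_div_of_nonneg_left (sq_nonneg _) (by positivity) (by nlinarith)
  have h6 : (v - 1) / (2 * B) + (v - 1) ^ 2 / (4 * B) = (v ^ 2 - 1) / (4 * B) := by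
    field_simp
    ring
  linarith

/-- Averaging `exp_tempered_le` over the true label turns exp(llr/2) into 1 − h, so the tempered
variable inherits a Hellinger drift, scaled by s/B. -/
lemma sigmoid_exp_tempered_add_le {a b s B R : ℝ} (hs : 0 < s) (hs4 : s ≤ 1 / 4)
    (hb : |b| ≤ R) (hB : exp (s * (1 + R)) ≤ B) :
    sigmoid b * exp ((exp (s * llr a b) - 1) / (2 * B)) +
      sigmoid (-b) * exp ((exp (s * llr (-a) (-b)) - 1) / (2 * B)) ≤ exp (-(s / B * hell a b)) := by
  have hR : 0 ≤ R := (abs_nonneg b).trans hb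
  have hB1 : 1 ≤ B := (Real.one_le_exp (by positivity)).trans hB
  have key : ∀ {a b : ℝ}, |b| ≤ R → exp ((exp (s * llr a b) - 1) / (2 * B)) ≤
      1 + s / B * (exp (llr a b / 2) - 1) := fun h =>
    exp_tempered_le hs hs4 hB1 ((Real.exp_le_exp.2
      (mul_le_mul_of_nonneg_left (llr_le h) hs.le)).trans hB)
  have h1 := mul_le_mul_of_nonneg_left (key (a := a) hb) (Real.sigmoid_nonneg b)
  have h2 := mul_le_mul_of_nonneg_left (key (a := -a) (b := -b) (by rwa [abs_neg]))
    (Real.sigmoid_nonneg (-b))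
  have h3 := sigmoid_exp_half_add a b
  have h4 := Real.sigmoid_neg b
  have h5 := Real.add_one_le_exp (-(s / B * hell a b))
  have h6 : sigmoid b * (1 + s / B * (exp (llr a b / 2) - 1)) +
      sigmoid (-b) * (1 + s / B * (exp (llr (-a) (-b) / 2) - 1)) =
      (sigmoid b + sigmoid (-b)) * (1 - s / B) + s / B * (sigmoid b * exp (llr a b / 2) +
        sigmoid (-b) * exp (llr (-a) (-b) / 2)) := by ring
  have h7 : sigmoid b + sigmoid (-b) = 1 := by linarith
  rw [h3, h7] at h6
  linarith

lemma exp_le_cosh_add {l y b : ℝ} (hb : 0 < b) (hy : |y| ≤ b) :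
    exp (l * y) ≤ Real.cosh (l * b) + y / b * Real.sinh (l * b) := by
  have hy' := abs_le.1 hy
  have h1 : 0 ≤ (1 + y / b) / 2 := by
    have : -1 ≤ y / b := by rw [le_div_iff₀ hb]; linarith
    linarith
  have h2 : 0 ≤ (1 - y / b) / 2 := by
    have : y / b ≤ 1 := by rw [div_le_one hb]; linarith
    linarith
  have h := convexOn_exp.2 (Set.mem_univ (l * b)) (Set.mem_univ (-(l * b))) h1 h2 (by ring)
  simp only [smul_eq_mul] at h
  have e : (1 + y / b) / 2 * (l * b) + (1 - y / b) / 2 * -(l * b) = l * y := by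
    field_simp
    ring
  rw [e] at h
  rw [Real.cosh_eq, Real.sinh_eq]
  linarith

/-- Hoeffding's lemma. -/
lemma lexpect_exp_le {α : Type*} {p : PMF α} {f : α → ℝ} {b : ℝ} (hb : 0 < b)
    (hf : ∀ x, p x ≠ 0 → |f x| ≤ b) (h0 : expect p f = 0) (l : ℝ) :
    lexpect p (fun x => ENNReal.ofReal (exp (l * f x))) ≤
      ENNReal.ofReal (exp (l ^ 2 * b ^ 2 / 2)) := by
  have hle : ∀ x, p x ≠ 0 → exp (l * f x) ≤ Real.cosh (l * b) + Real.sinh (l * b) / b * f x :=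
    fun x hx => (exp_le_cosh_add hb (hf x hx)).trans_eq (by ring)
  have hb1 : ∀ x, p x ≠ 0 → |exp (l * f x)| ≤ exp (|l| * b) := fun x hx => by
    rw [abs_of_pos (Real.exp_pos _)]
    refine Real.exp_le_exp.2 ((le_abs_self _).trans ?_)
    rw [abs_mul]
    exact mul_le_mul_of_nonneg_left (hf x hx) (abs_nonneg _)
  have hb2 : ∀ x, p x ≠ 0 → |Real.sinh (l * b) / b * f x| ≤ |Real.sinh (l * b) / b| * b :=
    fun x hx => by
      rw [abs_mul]
      exact mul_le_mul_of_nonneg_left (hf x hx) (abs_nonneg _)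
  rw [lexpect_ofReal hb1 fun x _ => (Real.exp_pos _).le]
  refine ENNReal.ofReal_le_ofReal ?_
  calc expect p (fun x => exp (l * f x))
      ≤ expect p (fun x => Real.cosh (l * b) + Real.sinh (l * b) / b * f x) :=
        expect_mono hb1 (b' := |Real.cosh (l * b)| + |Real.sinh (l * b) / b| * b)
          (fun x hx => (abs_add_le _ _).trans (add_le_add le_rfl (hb2 x hx))) hle
    _ = Real.cosh (l * b) := by
        rw [expect_add (fun _ _ => le_rfl) hb2, expect_const, expect_const_mul, h0, mul_zero,
          add_zero]
    _ ≤ exp ((l * b) ^ 2 / 2) := Real.cosh_le_exp_half_sq _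
    _ = _ := by rw [mul_pow]

lemma lexpect_indep_exp_sum {α : Type*} {n : ℕ} (p : Fin n → PMF α) (f : Fin n → α → ℝ)
    (c : Fin n → ℝ) {K : ℝ} (hK : 0 < K)
    (h : ∀ i, lexpect (p i) (fun x => ENNReal.ofReal (exp (f i x))) ≤
      ENNReal.ofReal (exp (-c i))) :
    lexpect (indep n p) (fun x => ENNReal.ofReal (exp (∑ i, f i (x i) + ∑ i, c i) / K)) ≤
      ENNReal.ofReal (1 / K) := by
  have e : ∀ x : Fin n → α, ENNReal.ofReal (exp (∑ i, f i (x i) + ∑ i, c i) / K) =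
      ENNReal.ofReal (exp (∑ i, c i) / K) * ∏ i, ENNReal.ofReal (exp (f i (x i))) := fun x => by
    rw [← ENNReal.ofReal_prod_of_nonneg fun _ _ => (Real.exp_pos _).le, ← Real.exp_sum,
      ← ENNReal.ofReal_mul (by positivity), Real.exp_add]
    congr 1
    ring
  simp only [e]
  rw [lexpect_const_mul, lexpect_indep_prod p fun i y => ENNReal.ofReal (exp (f i y))]
  calc _ ≤ ENNReal.ofReal (exp (∑ i, c i) / K) * ∏ i, ENNReal.ofReal (exp (-c i)) := by
        gcongr with i
        exact h i
    _ = ENNReal.ofReal (1 / K) := by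
        rw [← ENNReal.ofReal_prod_of_nonneg fun _ _ => (Real.exp_pos _).le, ← Real.exp_sum,
          ← ENNReal.ofReal_mul (by positivity), Finset.sum_neg_distrib, div_mul_eq_mul_div,
          ← Real.exp_add, add_neg_cancel, Real.exp_zero]

lemma lexpect_uniform {n : ℕ} [NeZero n] (f : Fin n → ℝ) (hf : ∀ i, 0 ≤ f i) :
    lexpect (PMF.uniformOfFintype (Fin n)) (fun i => ENNReal.ofReal (f i)) =
      ENNReal.ofReal ((∑ i, f i) / n) := by
  have hn : (0 : ℝ) < n := Nat.cast_pos.2 (NeZero.pos n)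
  simp only [lexpect, PMF.uniformOfFintype_apply, tsum_fintype, Fintype.card_fin]
  rw [← Finset.mul_sum, ← ENNReal.ofReal_sum_of_nonneg fun i _ => hf i, div_eq_inv_mul,
    ENNReal.ofReal_mul (by positivity), ENNReal.ofReal_inv_of_pos hn, ENNReal.ofReal_natCast]

/-! ### Label models of policies and exponential moments of the datasets -/

namespace Problem

variable {S A : Type*} {H N : ℕ} (P : Problem S A H N)

/-- The standing assumptions on the problem. -/
structure Regular (V R : ℝ) (πstar : Policy S A H) : Prop where
  β_pos : 0 < P.β
  ref_mem : P.ref ∈ P.cls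
  offline : P.OfflinePossible
  samp : P.SampPossible
  reward : P.RewardBounded R
  optimal : P.IsOptimal πstar
  star_mem : πstar ∈ P.cls
  ratio : P.RatioBounded V

/-- Both trajectories of the pair are possible under `π_ref`. -/
def Possible (x : S × (Fin H → A) × (Fin H → A)) : Prop :=
  P.mdp.init x.1 ≠ 0 ∧ P.mdp.prob P.ref (x.1, x.2.1) ≠ 0 ∧ P.mdp.prob P.ref (x.1, x.2.2) ≠ 0

/-- The log-odds that the policy, as an implicit reward model, assigns to a labelled pair. -/
def margin (π : Policy S A H) (z : Traj S A H × Traj S A H) : ℝ :=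
  P.β * P.logRatio π z.1 - P.β * P.logRatio π z.2

/-- The pair of trajectories with a common initial state. -/
def toPair (x : S × (Fin H → A) × (Fin H → A)) : Traj S A H × Traj S A H :=
  ((x.1, x.2.1), (x.1, x.2.2))

/-- The log-likelihood ratio of a label under `π` against `π'`. -/
def pairLlr (π π' : Policy S A H) (z : Traj S A H × Traj S A H) : ℝ :=
  llr (P.margin π z) (P.margin π' z)

/-- The Hellinger distance of the label distributions of `π` and `π'`. -/
def pairHell (π π' : Policy S A H) (x : S × (Fin H → A) × (Fin H → A)) : ℝ :=
  hell (P.margin π (toPair x)) (P.margin π' (toPair x))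

/-- The sampler of the algorithm, as a function of the policies so far. -/
def effSampler (l : List (Policy S A H)) : Sampler S A H :=
  if l.length = 1 then P.mdp.sampler P.ref else P.samp l

/-- The law of the online pair of round `i + 1`, as a function of the policies so far. -/
def roundLaw (l : List (Policy S A H)) (i : ℕ) : PMF (S × (Fin H → A) × (Fin H → A)) :=
  P.mdp.pairLaw (P.mdp.sampler (l.getD i P.ref)) (P.effSampler (l.take (i + 1)))

/-- The average of `f` over the offline pairs. -/
def offMean (f : S × (Fin H → A) × (Fin H → A) → ℝ) : ℝ := (∑ i, f (P.offPairs i)) / N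

lemma roundLaw_append (l : List (Policy S A H)) (π : Policy S A H) {i : ℕ} (hi : i < l.length) :
    P.roundLaw (l ++ [π]) i = P.roundLaw l i := by
  rw [roundLaw, roundLaw, List.getD_append _ _ _ _ hi, List.take_append_of_le_length hi]

lemma roundLaw_take (l : List (Policy S A H)) {i t : ℕ} (hi : i < t) :
    P.roundLaw (l.take t) i = P.roundLaw l i := by
  rw [roundLaw, roundLaw, List.take_take, min_eq_left hi, List.getD_eq_getElem?_getD,
    List.getD_eq_getElem?_getD, List.getElem?_take_of_lt hi]

section regular

variable {P} {V R : ℝ} {πstar : Policy S A H}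

lemma Regular.logRatio_le (h : P.Regular V R πstar) {π : Policy S A H} (hπ : π ∈ P.cls)
    (τ : Traj S A H) : |P.β * P.logRatio π τ| ≤ V := by
  rw [abs_mul, abs_of_pos h.β_pos, ← le_div_iff₀' h.β_pos]
  exact (h.ratio π hπ τ).2

lemma Regular.V_nonneg (h : P.Regular V R πstar) : 0 ≤ V := by
  obtain ⟨s, -⟩ := P.mdp.init.support_nonempty
  obtain ⟨a, -⟩ := (P.mdp.sampler P.ref s).support_nonempty
  exact (abs_nonneg _).trans (h.logRatio_le h.ref_mem (s, a))

lemma Regular.R_nonneg (h : P.Regular V R πstar) : 0 ≤ R := by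
  obtain ⟨s, -⟩ := P.mdp.init.support_nonempty
  obtain ⟨a, -⟩ := (P.mdp.sampler P.ref s).support_nonempty
  exact (h.reward (s, a)).1.trans (h.reward (s, a)).2

lemma Regular.margin_star (h : P.Regular V R πstar) {x : S × (Fin H → A) × (Fin H → A)}
    (hx : P.Possible x) : P.margin πstar (toPair x) =
      P.mdp.totalReward (x.1, x.2.1) - P.mdp.totalReward (x.1, x.2.2) := by
  simp only [margin, toPair]
  rw [optimal_logRatio h.β_pos h.reward h.ratio h.optimal h.star_mem (τ := (x.1, x.2.1)) hx.1
    hx.2.1, optimal_logRatio h.β_pos h.reward h.ratio h.optimal h.star_mem (τ := (x.1, x.2.2)) hx.1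
    hx.2.2]
  ring

lemma Regular.abs_margin_star (h : P.Regular V R πstar) {x : S × (Fin H → A) × (Fin H → A)}
    (hx : P.Possible x) : |P.margin πstar (toPair x)| ≤ R := by
  rw [h.margin_star hx, abs_le]
  have h1 := h.reward (x.1, x.2.1)
  have h2 := h.reward (x.1, x.2.2)
  constructor <;> linarith

lemma Regular.g_eq (h : P.Regular V R πstar) {x : S × (Fin H → A) × (Fin H → A)}
    (hx : P.Possible x) (π : Policy S A H) :
    P.g π x = P.margin π (toPair x) - P.margin πstar (toPair x) := by
  rw [h.margin_star hx]
  simp only [g, margin, toPair]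
  ring

lemma margin_swap (π : Policy S A H) (z : Traj S A H × Traj S A H) :
    P.margin π z.swap = -P.margin π z := by
  simp only [margin, Prod.fst_swap, Prod.snd_swap]
  ring

/-- The optimal policy reproduces the oracle: its margin is the reward difference, so labels of
possible pairs are Bernoulli with log-odds `P.margin πstar`. -/
lemma Regular.lexpect_label (h : P.Regular V R πstar) {x : S × (Fin H → A) × (Fin H → A)}
    (hx : P.Possible x) (π : Policy S A H) (F : ℝ → ℝ) (hF : ∀ y, 0 ≤ F y) :
    lexpect (P.mdp.label x) (fun z => ENNReal.ofReal (F (P.pairLlr π πstar z))) =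
      ENNReal.ofReal (sigmoid (P.margin πstar (toPair x)) *
          F (llr (P.margin π (toPair x)) (P.margin πstar (toPair x))) +
        sigmoid (-P.margin πstar (toPair x)) *
          F (llr (-P.margin π (toPair x)) (-P.margin πstar (toPair x)))) := by
  rw [P.mdp.lexpect_label, P.mdp.prefProb_eq_sigmoid, P.mdp.prefProb_eq_sigmoid,
    ENNReal.ofReal_add (mul_nonneg (Real.sigmoid_nonneg _) (hF _))
      (mul_nonneg (Real.sigmoid_nonneg _) (hF _)), ENNReal.ofReal_mul (Real.sigmoid_nonneg _),
    ENNReal.ofReal_mul (Real.sigmoid_nonneg _), ← margin_swap, ← margin_swap]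
  congr 3
  · rw [h.margin_star hx]
  · rw [margin_swap, h.margin_star hx, neg_sub]

lemma Regular.effSampler_support (h : P.Regular V R πstar) {l : List (Policy S A H)}
    (hl : ∀ π ∈ l, π ∈ P.cls) {s : S} {a : Fin H → A} (ha : P.effSampler l s a ≠ 0) :
    P.mdp.prob P.ref (s, a) ≠ 0 := by
  unfold effSampler at ha
  split_ifs at ha with h1
  · exact sampler_ref_ne_zero h.ratio h.ref_mem ha
  · exact fun h0 => ha (h.samp l hl s a h0)

lemma Regular.possible_of_pairLaw (h : P.Regular V R πstar) {π : Policy S A H} (hπ : π ∈ P.cls)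
    {q : Sampler S A H} (hq : ∀ s a, q s a ≠ 0 → P.mdp.prob P.ref (s, a) ≠ 0)
    {x : S × (Fin H → A) × (Fin H → A)} (hx : P.mdp.pairLaw (P.mdp.sampler π) q x ≠ 0) :
    P.Possible x := by
  obtain ⟨h1, h2, h3⟩ := P.mdp.pairLaw_support hx
  exact ⟨h1, sampler_ref_ne_zero h.ratio hπ h2, hq _ _ h3⟩

lemma Regular.getD_mem (h : P.Regular V R πstar) {l : List (Policy S A H)}
    (hl : ∀ π ∈ l, π ∈ P.cls) (i : ℕ) : l.getD i P.ref ∈ P.cls := by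
  rw [List.getD_eq_getElem?_getD]
  cases hi : l[i]? with
  | none => exact h.ref_mem
  | some π => exact hl _ (List.mem_of_getElem? hi)

lemma Regular.possible_of_roundLaw (h : P.Regular V R πstar) {l : List (Policy S A H)}
    (hl : ∀ π ∈ l, π ∈ P.cls) {i : ℕ} {x : S × (Fin H → A) × (Fin H → A)}
    (hx : P.roundLaw l i x ≠ 0) : P.Possible x :=
  h.possible_of_pairLaw (h.getD_mem hl i) (fun _ _ ha =>
    h.effSampler_support (fun π hπ => hl π (List.mem_of_mem_take hπ)) ha) hx

lemma abs_pairHell_le (π π' : Policy S A H) (x : S × (Fin H → A) × (Fin H → A)) :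
    |P.pairHell π π' x| ≤ 1 := abs_hell_le_one _ _

/-- The half-likelihood moment of an online label. -/
lemma Regular.lexpect_exp_half (h : P.Regular V R πstar)
    {p : PMF (S × (Fin H → A) × (Fin H → A))} (hp : ∀ x, p x ≠ 0 → P.Possible x)
    (π : Policy S A H) :
    lexpect (p.bind P.mdp.label) (fun z => ENNReal.ofReal (exp (P.pairLlr π πstar z / 2))) ≤
      ENNReal.ofReal (exp (-expect p (P.pairHell π πstar))) := by
  rw [lexpect_bind]
  have e : ∀ x, p x ≠ 0 → lexpect (P.mdp.label x)
      (fun z => ENNReal.ofReal (exp (P.pairLlr π πstar z / 2))) =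
        ENNReal.ofReal (1 - P.pairHell π πstar x) := fun x hx => by
    rw [h.lexpect_label (hp x hx) π (fun y => exp (y / 2)) fun y => (Real.exp_pos _).le,
      sigmoid_exp_half_add, pairHell]
  have hb := fun x (_ : p x ≠ 0) => abs_pairHell_le (P := P) π πstar x
  rw [lexpect_congr e, lexpect_ofReal (b := 2), expect_sub (b := 1) (by simp) hb, expect_const]
  · refine ENNReal.ofReal_le_ofReal ?_
    linarith [Real.add_one_le_exp (-expect p (P.pairHell π πstar))]
  · intro x _
    have := abs_le.1 (abs_pairHell_le (P := P) π πstar x)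
    rw [abs_le]
    constructor <;> linarith
  · intro x _
    have := abs_le.1 (abs_pairHell_le (P := P) π πstar x)
    linarith

end regular

/-- The offline labels are representative: the tempered likelihood ratios of all policies
concentrate. -/
def OffOK (πstar : Policy S A H) (s B ℓ : ℝ) (off : Fin N → Traj S A H × Traj S A H) : Prop :=
  ∀ π ∈ P.cls, ∑ i, (exp (s * P.pairLlr π πstar (off i)) - 1) / (2 * B) +
    ∑ i, s / B * P.pairHell π πstar (P.offPairs i) ≤ ℓ

-- A union bound over the class, with the tempered moment bound applied to each independent offline
-- label.
open Classical in
lemma Regular.lexpect_not_offOK {V R : ℝ} {πstar : Policy S A H} {P : Problem S A H N}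
    (h : P.Regular V R πstar) {s B K : ℝ} (hs : 0 < s) (hs4 : s ≤ 1 / 4)
    (hB : exp (s * (1 + R)) ≤ B) (hK : 0 < K) :
    lexpect (indep N fun i => P.mdp.label (P.offPairs i))
      (fun off => if ¬P.OffOK πstar s B (log K) off then 1 else 0) ≤
      P.cls.card * ENNReal.ofReal (1 / K) := by
  calc _ ≤ lexpect (indep N fun i => P.mdp.label (P.offPairs i)) (fun off => ∑ π ∈ P.cls,
        ENNReal.ofReal (exp (∑ i, (exp (s * P.pairLlr π πstar (off i)) - 1) / (2 * B) +
          ∑ i, s / B * P.pairHell π πstar (P.offPairs i)) / K)) := by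
        refine lexpect_mono fun off _ => indicator_le_sum_exp _ _ K hK fun hq => ?_
        unfold OffOK at hq
        push Not at hq
        exact hq
    _ ≤ ∑ π ∈ P.cls, ENNReal.ofReal (1 / K) := by
        rw [lexpect_sum]
        refine Finset.sum_le_sum fun π _ => lexpect_indep_exp_sum
          (fun i => P.mdp.label (P.offPairs i))
          (fun _ z => (exp (s * P.pairLlr π πstar z) - 1) / (2 * B)) _ hK fun i => ?_
        rw [h.lexpect_label (h.offline i) π (fun y => exp ((exp (s * y) - 1) / (2 * B)))
          fun y => (Real.exp_pos _).le]
        exact ENNReal.ofReal_le_ofReal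
          (sigmoid_exp_tempered_add_le hs hs4 (h.abs_margin_star (h.offline i)) hB)
    _ = _ := by rw [Finset.sum_const, nsmul_eq_mul]

/-- The tempered likelihood ratio of a batch, given the offline labels. -/
lemma lexpect_batch [NeZero N] (π πstar : Policy S A H) (s c : ℝ) {K : ℝ} (hK : 0 < K)
    (off : Fin N → Traj S A H × Traj S A H)
    (hc : (∑ i, exp (s * P.pairLlr π πstar (off i))) / N - 1 ≤ c) (n : ℕ) :
    lexpect (indep n fun _ => (PMF.uniformOfFintype (Fin N)).map off)
      (fun batch => ENNReal.ofReal
        (exp (∑ i, s * P.pairLlr π πstar (batch i) + ∑ _i : Fin n, -c) / K)) ≤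
      ENNReal.ofReal (1 / K) := by
  refine lexpect_indep_exp_sum (fun _ => (PMF.uniformOfFintype (Fin N)).map off)
    (fun _ z => s * P.pairLlr π πstar z) _ hK fun i => ?_
  rw [lexpect_map, lexpect_uniform _ fun i => (Real.exp_pos _).le, neg_neg]
  exact ENNReal.ofReal_le_ofReal (by linarith [Real.add_one_le_exp c])

/-- This is the per-draw exponential moment of a uniformly drawn label, in the form that
`lexpect_batch` consumes. -/
lemma OffOK.mean_le {P : Problem S A H N} [NeZero N] {πstar : Policy S A H} {s B ℓ : ℝ}
    (hB : 0 < B) {off : Fin N → Traj S A H × Traj S A H} (h : P.OffOK πstar s B ℓ off)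
    {π : Policy S A H} (hπ : π ∈ P.cls) :
    (∑ i, exp (s * P.pairLlr π πstar (off i))) / N - 1 ≤
      2 * B * ℓ / N - 2 * s * P.offMean (P.pairHell π πstar) := by
  have hn : (0 : ℝ) < N := Nat.cast_pos.2 (NeZero.pos N)
  have h1 := h π hπ
  rw [← Finset.sum_div, ← Finset.mul_sum, Finset.sum_sub_distrib] at h1
  simp only [Finset.sum_const, Finset.card_univ, Fintype.card_fin, nsmul_eq_mul, mul_one] at h1
  rw [offMean]
  set x := ∑ i, exp (s * P.pairLlr π πstar (off i))
  set y := ∑ i, P.pairHell π πstar (P.offPairs i)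
  have h2 : x - N + 2 * s * y ≤ 2 * B * ℓ := by
    calc x - N + 2 * s * y = 2 * B * ((x - N) / (2 * B) + s / B * y) := by field_simp
      _ ≤ 2 * B * ℓ := by gcongr
  calc x / N - 1 = (x - N + 2 * s * y) / N - 2 * s * (y / N) := by field_simp; ring
    _ ≤ _ := by gcongr

/-- Deviations of the optimism dataset. -/
lemma lexpect_optimism {α : Type*} {p : PMF α} {f : α → ℝ} {b : ℝ} (hb : 0 < b)
    (hf : ∀ x, p x ≠ 0 → |f x| ≤ b / 2) (l : ℝ) {K : ℝ} (hK : 0 < K) (n : ℕ) :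
    lexpect (indep n fun _ => p) (fun x => ENNReal.ofReal
      (exp (∑ i, l * (expect p f - f (x i)) + ∑ _i : Fin n, -(l ^ 2 * b ^ 2 / 2)) / K)) ≤
      ENNReal.ofReal (1 / K) := by
  refine lexpect_indep_exp_sum (fun _ => p) (fun _ x => l * (expect p f - f x)) _ hK fun i => ?_
  rw [neg_neg]
  -- Both the mean and the sample are at most b/2 in absolute value, so the centred variable is
  -- bounded by `b`, as Hoeffding's lemma requires.
  have h1 := abs_expect_le hf
  refine lexpect_exp_le hb (fun x hx => (abs_sub _ _).trans
    ((add_le_add h1 (hf x hx)).trans (add_halves b).le)) ?_ l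
  rw [expect_sub (fun _ _ => h1) hf, expect_const, sub_self]

end Problem

/-! ### The guarantee of a round and its propagation along the run -/

namespace Problem

variable {S A : Type*} {H N : ℕ} (P : Problem S A H N)

/-- The cumulative Hellinger distance over the online rounds. -/
def cumHell (πstar π : Policy S A H) (l : List (Policy S A H)) (n : ℕ) : ℝ :=
  ∑ i ∈ Finset.range n, expect (P.roundLaw l i) (P.pairHell π πstar)

/-- The guarantee for the policy `π` chosen after the policies `l`. -/
def StepOK (πstar : Policy S A H) (α s b B ℓ : ℝ) (l : List (Policy S A H))
    (π : Policy S A H) : Prop :=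
  α * (((l.length + P.γ : ℕ) : ℝ) * expect (P.mdp.trajLaw (P.effSampler l))
      (fun τ => P.logRatio π τ - P.logRatio πstar τ) -
        b * √(2 * ((l.length + P.γ : ℕ) : ℝ) * ℓ)) +
    2 * (P.cumHell πstar π l l.length + P.γ * P.offMean (P.pairHell π πstar)) ≤
    2 * ℓ + (1 + 2 * (P.γ / N) * B) * ℓ / s

/-- The invariant of the run: bookkeeping of the policies. -/
structure Inv (t : ℕ) (st : RunState S A H) : Prop where
  length : st.policies.length = t + 1
  mem : ∀ π ∈ st.policies, π ∈ P.cls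
  current : st.current = st.policies.getD t P.ref
  sampler : st.sampler = P.effSampler st.policies

/-- The exponent of the likelihood-ratio supermartingale of the online labels. -/
def onlineLlr (πstar π : Policy S A H) (st : RunState S A H) : ℝ :=
  (st.online.map fun z => P.pairLlr π πstar z / 2).sum +
    P.cumHell πstar π st.policies (st.policies.length - 1)

lemma cumHell_append (πstar π π' : Policy S A H) (l : List (Policy S A H)) {n : ℕ}
    (hn : n ≤ l.length) : P.cumHell πstar π (l ++ [π']) n = P.cumHell πstar π l n := by
  refine Finset.sum_congr rfl fun i hi => ?_
  rw [P.roundLaw_append l π' ((Finset.mem_range.1 hi).trans_le hn)]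

variable {P} {V R α : ℝ} {πstar : Policy S A H} {upd : UpdateRule S A H}

lemma Inv.roundLaw_eq {t : ℕ} {st : RunState S A H} (hst : P.Inv t st) :
    P.roundLaw st.policies t = P.mdp.pairLaw (P.mdp.sampler st.current) st.sampler := by
  rw [roundLaw, hst.current, hst.sampler, List.take_of_length_le hst.length.le]

lemma Inv.possible (h : P.Regular V R πstar) {t : ℕ} {st : RunState S A H} (hst : P.Inv t st)
    {x : S × (Fin H → A) × (Fin H → A)}
    (hx : P.mdp.pairLaw (P.mdp.sampler st.current) st.sampler x ≠ 0) : P.Possible x := by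
  rw [← hst.roundLaw_eq] at hx
  exact h.possible_of_roundLaw hst.mem hx

lemma log_prob_sub (h : P.Regular V R πstar) {π : Policy S A H} (hπ : π ∈ P.cls)
    {τ : Traj S A H} (hτ : P.mdp.prob P.ref τ ≠ 0) :
    log (P.mdp.prob π τ) - log (P.mdp.prob πstar τ) = P.logRatio π τ - P.logRatio πstar τ := by
  have h1 : P.mdp.prob π τ ≠ 0 := fun h0 => hτ ((h.ratio π hπ τ).1.1 h0)
  have h2 : P.mdp.prob πstar τ ≠ 0 := fun h0 => hτ ((h.ratio πstar h.star_mem τ).1.1 h0)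
  rw [logRatio, logRatio, Real.log_div h1 hτ, Real.log_div h2 hτ]
  ring

lemma sum_map_pairLlr (π π' : Policy S A H) (l : List (Traj S A H × Traj S A H)) :
    (l.map fun z => P.pairLlr π π' z).sum = (l.map fun z => log (sigmoid (P.margin π z))).sum -
      (l.map fun z => log (sigmoid (P.margin π' z))).sum := by
  induction l with
  | nil => simp
  | cons z l ih =>
    simp only [List.map_cons, List.sum_cons, ih]
    rw [pairLlr, llr]
    ring

/-- The optimality of the update, in terms of log-likelihood ratios. -/
lemma optimism_le (h : P.Regular V R πstar) (hupd : P.IsArgminRule α upd)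
    (hist : List (Policy S A H)) (online : List (Traj S A H × Traj S A H)) {n m : ℕ}
    (batch : Fin n → Traj S A H × Traj S A H) (opt : Fin m → Traj S A H)
    (hopt : ∀ i, P.mdp.prob P.ref (opt i) ≠ 0) {π : Policy S A H}
    (hπ : π = upd hist (List.ofFn opt) (online ++ List.ofFn batch)) :
    α * ∑ i, (P.logRatio π (opt i) - P.logRatio πstar (opt i)) ≤
      (online.map fun z => P.pairLlr π πstar z).sum + ∑ i, P.pairLlr π πstar (batch i) := by
  obtain ⟨h1, h2⟩ := hupd hist (List.ofFn opt) (online ++ List.ofFn batch)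
  have h3 := h2 πstar h.star_mem
  rw [← hπ] at h1 h3
  have e : ∀ π' : Policy S A H, P.loss α (List.ofFn opt) (online ++ List.ofFn batch) π' =
      α * ∑ i, log (P.mdp.prob π' (opt i)) -
        ((online.map fun z => log (sigmoid (P.margin π' z))).sum +
          ∑ i, log (sigmoid (P.margin π' (batch i)))) := fun π' => by
    simp only [loss, List.map_append, List.sum_append, List.map_ofFn, List.sum_ofFn]
    rfl
  have e1 : (online.map fun z => P.pairLlr π πstar z).sum =
      (online.map fun z => log (sigmoid (P.margin π z))).sum -
        (online.map fun z => log (sigmoid (P.margin πstar z))).sum := by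
    rw [sum_map_pairLlr]
  have e2 : ∑ i, P.pairLlr π πstar (batch i) = ∑ i, log (sigmoid (P.margin π (batch i))) -
      ∑ i, log (sigmoid (P.margin πstar (batch i))) := by
    rw [← Finset.sum_sub_distrib]
    rfl
  have e3 : ∑ i, (P.logRatio π (opt i) - P.logRatio πstar (opt i)) =
      ∑ i, log (P.mdp.prob π (opt i)) - ∑ i, log (P.mdp.prob πstar (opt i)) := by
    rw [← Finset.sum_sub_distrib]
    exact Finset.sum_congr rfl fun i _ => (log_prob_sub h h1 (hopt i)).symm
  rw [e, e] at h3
  rw [e1, e2, e3, mul_sub]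
  linarith

/-- The rate of the exponential moment for the optimism dataset. -/
def optRate (b ℓ : ℝ) (n : ℕ) : ℝ := √(2 * ℓ / n) / b

/-- A Chernoff bound at rate λ gives the deviation ℓ/λ + nλb²/2. `optRate` is the λ at which the two
parts agree, with total b√(2nℓ). -/
lemma sum_ge_of_optRate {b ℓ e x : ℝ} {n : ℕ} (hb : 0 < b) (hℓ : 0 < ℓ) (hn : 0 < n)
    (hx : optRate b ℓ n * (n * e - x) - n * (optRate b ℓ n ^ 2 * b ^ 2 / 2) ≤ ℓ) :
    n * e - b * √(2 * n * ℓ) ≤ x := by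
  have hn' : (0 : ℝ) < n := Nat.cast_pos.2 hn
  have hr : 0 < optRate b ℓ n := div_pos (Real.sqrt_pos.2 (by positivity)) hb
  have h1 : optRate b ℓ n ^ 2 * b ^ 2 = 2 * ℓ / n := by
    rw [optRate, div_pow, Real.sq_sqrt (by positivity)]
    field_simp
  have h2 : optRate b ℓ n * (b * √(2 * n * ℓ)) = 2 * ℓ := by
    rw [optRate, div_mul_eq_mul_div, mul_left_comm, mul_div_cancel_left₀ _ hb.ne',
      ← Real.sqrt_mul (by positivity), show 2 * ℓ / n * (2 * n * ℓ) = (2 * ℓ) ^ 2 by field_simp,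
      Real.sqrt_sq (by positivity)]
  have h3 : (n : ℝ) * (2 * ℓ / n / 2) = ℓ := by field_simp
  rw [h1, h3] at hx
  have h4 : optRate b ℓ n * (n * e - x) ≤ optRate b ℓ n * (b * √(2 * n * ℓ)) := by
    rw [h2]
    linarith
  linarith [le_of_mul_le_mul_left h4 hr]

/-- The exponent of the online supermartingale after the pair `z` has been added to the buffer. -/
def onlineExp (P : Problem S A H N) (πstar : Policy S A H) (st : RunState S A H)
    (z : Traj S A H × Traj S A H) (π : Policy S A H) : ℝ :=
  ((st.online ++ [z]).map fun z => P.pairLlr π πstar z / 2).sum +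
    P.cumHell πstar π st.policies st.policies.length

/-- The deterministic half of a round. `h1` and `h2` bound the online and batch likelihood ratios
from above, `h3` bounds the optimism sum from below, and `optimism_le` joins them. The factor 2 in
the guarantee undoes the half in the online exponent. -/
lemma stepOK_of_exponents (h : P.Regular V R πstar) (hα : 0 ≤ α) (hupd : P.IsArgminRule α upd)
    {s b B ℓ : ℝ} (hs : 0 < s) (hb : 0 < b) (hℓ : 0 < ℓ) (st : RunState S A H)
    (hlen : 0 < st.policies.length)
    (z : Traj S A H × Traj S A H) {n : ℕ}
    (batch : Fin P.γ → Traj S A H × Traj S A H) (opt : Fin n → Traj S A H)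
    (hn : n = st.policies.length + P.γ)
    (hopt : ∀ i, P.mdp.prob P.ref (opt i) ≠ 0) {π : Policy S A H}
    (hπ : π = upd st.policies (List.ofFn opt) (st.online ++ [z] ++ List.ofFn batch))
    (h1 : P.onlineExp πstar st z π ≤ ℓ)
    (h2 : ∑ i, s * P.pairLlr π πstar (batch i) + ∑ _i : Fin P.γ,
      -(2 * B * ℓ / N - 2 * s * P.offMean (P.pairHell π πstar)) ≤ ℓ)
    (h3 : ∑ i, optRate b ℓ n * (expect (P.mdp.trajLaw (P.effSampler st.policies))
        (fun τ => P.logRatio π τ - P.logRatio πstar τ) -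
          (P.logRatio π (opt i) - P.logRatio πstar (opt i))) +
        ∑ _i : Fin n, -(optRate b ℓ n ^ 2 * b ^ 2 / 2) ≤ ℓ) :
    P.StepOK πstar α s b B ℓ st.policies π := by
  have h4 := optimism_le h hupd _ _ batch opt hopt hπ
  set E := expect (P.mdp.trajLaw (P.effSampler st.policies))
    (fun τ => P.logRatio π τ - P.logRatio πstar τ) with hE
  have h5 : (n : ℝ) * E - b * √(2 * n * ℓ) ≤
      ∑ i, (P.logRatio π (opt i) - P.logRatio πstar (opt i)) := by
    refine sum_ge_of_optRate hb hℓ (by omega) ?_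
    rw [← Finset.mul_sum, Finset.sum_sub_distrib] at h3
    simp only [Finset.sum_const, Finset.card_univ, Fintype.card_fin, nsmul_eq_mul] at h3
    linarith
  have h6 : ((st.online ++ [z]).map fun z => P.pairLlr π πstar z).sum =
      2 * ((st.online ++ [z]).map fun z => P.pairLlr π πstar z / 2).sum := by
    rw [← List.sum_map_mul_left]
    congr 2
    funext z
    ring
  have h7 : ∑ i, P.pairLlr π πstar (batch i) ≤
      (1 + 2 * (P.γ / N) * B) * ℓ / s - 2 * (P.γ * P.offMean (P.pairHell π πstar)) := by
    rw [← Finset.mul_sum] at h2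
    simp only [Finset.sum_const, Finset.card_univ, Fintype.card_fin, nsmul_eq_mul] at h2
    rw [le_sub_iff_add_le, le_div_iff₀ hs]
    calc _ = s * ∑ i, P.pairLlr π πstar (batch i) +
          P.γ * -(2 * B * ℓ / N - 2 * s * P.offMean (P.pairHell π πstar)) +
            2 * (P.γ / N) * B * ℓ := by ring
      _ ≤ ℓ + 2 * (P.γ / N) * B * ℓ := by gcongr
      _ = _ := by ring
  have h8 := mul_le_mul_of_nonneg_left h5 hα
  rw [h6] at h4
  unfold onlineExp at h1
  unfold StepOK
  rw [← hE, ← hn]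
  linarith

/-- The supermartingale step: E exp(llr/2) ≤ exp(−h) compensates the added Hellinger term. The
buffer is one pair behind the list of policies, since the last policy has not been played yet; hence
`length - 1` in `onlineLlr` and `length` in `onlineExp`. -/
lemma Inv.lexpect_onlineExp (h : P.Regular V R πstar) {t : ℕ} {st : RunState S A H} (hst : P.Inv t st) (π : Policy S A H) :
    lexpect ((P.mdp.pairLaw (P.mdp.sampler st.current) st.sampler).bind P.mdp.label)
      (fun z => ENNReal.ofReal (exp (P.onlineExp πstar st z π))) ≤
      ENNReal.ofReal (exp (P.onlineLlr πstar π st)) := by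
  have e : ∀ z, ENNReal.ofReal (exp (P.onlineExp πstar st z π)) =
      ENNReal.ofReal (exp (P.onlineLlr πstar π st +
        expect (P.roundLaw st.policies t) (P.pairHell π πstar))) *
          ENNReal.ofReal (exp (P.pairLlr π πstar z / 2)) := fun z => by
    rw [← ENNReal.ofReal_mul (Real.exp_pos _).le, ← Real.exp_add, onlineExp, onlineLlr, hst.length,
      cumHell, cumHell, Nat.add_sub_cancel, Finset.sum_range_succ]
    simp only [List.map_append, List.sum_append, List.map_cons, List.map_nil, List.sum_cons,
      List.sum_nil]
    congr 2
    ring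
  simp only [e]
  rw [lexpect_const_mul]
  calc _ ≤ ENNReal.ofReal (exp (P.onlineLlr πstar π st +
        expect (P.roundLaw st.policies t) (P.pairHell π πstar))) *
          ENNReal.ofReal (exp (-expect (P.roundLaw st.policies t) (P.pairHell π πstar))) := by
        gcongr
        rw [hst.roundLaw_eq]
        exact h.lexpect_exp_half (fun x hx => hst.possible h hx) π
    _ = _ := by
        rw [← ENNReal.ofReal_mul (Real.exp_pos _).le, ← Real.exp_add, add_neg_cancel_right]

section iter

variable [NeZero N] {off : Fin N → Traj S A H × Traj S A H} {t : ℕ} {st st' : RunState S A H}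

lemma lexpect_iter (F : RunState S A H → ℝ≥0∞) : lexpect (P.iter upd off st) F =
    lexpect ((P.mdp.pairLaw (P.mdp.sampler st.current) st.sampler).bind P.mdp.label) fun z =>
    lexpect (indep P.γ fun _ => (PMF.uniformOfFintype (Fin N)).map off) fun batch =>
    lexpect (indep (st.policies.length + P.γ) fun _ => P.mdp.trajLaw st.sampler) fun opt =>
      F { policies := st.policies ++
            [upd st.policies (List.ofFn opt) (st.online ++ [z] ++ List.ofFn batch)]
          current := upd st.policies (List.ofFn opt) (st.online ++ [z] ++ List.ofFn batch)
          sampler := P.samp (st.policies ++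
            [upd st.policies (List.ofFn opt) (st.online ++ [z] ++ List.ofFn batch)])
          online := st.online ++ [z] } := by
  simp only [iter, lexpect_bind, lexpect_map]

lemma Inv.iter (hupd : P.IsArgminRule α upd) (hst : P.Inv t st)
    (h' : P.iter upd off st st' ≠ 0) :
    P.Inv (t + 1) st' ∧ st'.policies = st.policies ++ [st'.current] := by
  have h1 : st' ∈ (P.iter upd off st).support := h'
  simp only [Problem.iter, PMF.mem_support_bind_iff, PMF.mem_support_map_iff] at h1
  obtain ⟨z, -, batch, -, opt, -, rfl⟩ := h1
  refine ⟨⟨?_, ?_, ?_, ?_⟩, rfl⟩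
  · simp [hst.length]
  · intro π hπ
    simp only [List.mem_append, List.mem_singleton] at hπ
    rcases hπ with hπ | rfl
    · exact hst.mem π hπ
    · exact (hupd _ _ _).1
  · simp only [List.getD_eq_getElem?_getD]
    rw [List.getElem?_append_right hst.length.le, show t + 1 - st.policies.length = 0 by
      rw [hst.length, Nat.sub_self]]
    rfl
  · rw [effSampler, if_neg]
    simp [hst.length]

lemma Inv.lexpect_iter_onlineLlr (h : P.Regular V R πstar) (hst : P.Inv t st)
    (π : Policy S A H) :
    lexpect (P.iter upd off st) (fun st' => ENNReal.ofReal (exp (P.onlineLlr πstar π st'))) ≤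
      ENNReal.ofReal (exp (P.onlineLlr πstar π st)) := by
  rw [lexpect_iter]
  refine le_trans (le_of_eq ?_) (hst.lexpect_onlineExp h π)
  simp only [onlineLlr, onlineExp, List.length_append, List.length_singleton, Nat.add_sub_cancel,
    P.cumHell_append _ _ _ _ le_rfl, lexpect_const]

-- The new policy depends on all the data, so a failure is charged to whichever of the three
-- exponents exceeds log K for that policy, and the sum over the class covers every possible choice.
-- The online term keeps the current value of the supermartingale, to be averaged over the run
-- later.
open Classical in
lemma Inv.lexpect_iter_not_stepOK (h : P.Regular V R πstar) (hα : 0 ≤ α)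
    (hupd : P.IsArgminRule α upd) {s b B K : ℝ} (hs : 0 < s) (hb : 0 < b) (hB : 0 < B)
    (hbV : 4 * V ≤ b * P.β) (hK : 1 < K) (hoff : P.OffOK πstar s B (log K) off)
    (hst : P.Inv t st) :
    lexpect (P.iter upd off st)
      (fun st' => if ¬P.StepOK πstar α s b B (log K) st.policies st'.current then 1 else 0) ≤
      (∑ π ∈ P.cls, ENNReal.ofReal (exp (P.onlineLlr πstar π st))) * ENNReal.ofReal (1 / K) +
        2 * P.cls.card * ENNReal.ofReal (1 / K) := by
  have hK0 : 0 < K := by linarith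
  have hℓ : 0 < log K := Real.log_pos hK
  have hβ := h.β_pos
  rw [lexpect_iter]
  set n := st.policies.length + P.γ with hn
  set f : Policy S A H → Traj S A H → ℝ := fun π τ => P.logRatio π τ - P.logRatio πstar τ with hf
  set ν := P.mdp.trajLaw (P.effSampler st.policies) with hν
  set a₁ : Traj S A H × Traj S A H → Policy S A H → ℝ := fun z π => P.onlineExp πstar st z π
  set a₂ : (Fin P.γ → Traj S A H × Traj S A H) → Policy S A H → ℝ := fun batch π =>
    ∑ i, s * P.pairLlr π πstar (batch i) + ∑ _i : Fin P.γ,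
      -(2 * B * log K / N - 2 * s * P.offMean (P.pairHell π πstar))
  set a₃ : (Fin n → Traj S A H) → Policy S A H → ℝ := fun opt π =>
    ∑ i, optRate b (log K) n * (expect ν (f π) - f π (opt i)) +
      ∑ _i : Fin n, -(optRate b (log K) n ^ 2 * b ^ 2 / 2)
  have key : ∀ z batch opt, indep n (fun _ => P.mdp.trajLaw st.sampler) opt ≠ 0 →
      (if ¬P.StepOK πstar α s b B (log K) st.policies
        (upd st.policies (List.ofFn opt) (st.online ++ [z] ++ List.ofFn batch)) then (1 : ℝ≥0∞)
        else 0) ≤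
      ∑ π ∈ P.cls, ENNReal.ofReal (exp (a₁ z π) / K) +
        (∑ π ∈ P.cls, ENNReal.ofReal (exp (a₂ batch π) / K) +
          ∑ π ∈ P.cls, ENNReal.ofReal (exp (a₃ opt π) / K)) := by
    intro z batch opt hopt
    have hmem := (hupd st.policies (List.ofFn opt) (st.online ++ [z] ++ List.ofFn batch)).1
    set π := upd st.policies (List.ofFn opt) (st.online ++ [z] ++ List.ofFn batch) with hπ
    rw [← Finset.sum_add_distrib, ← Finset.sum_add_distrib]
    refine le_trans ?_ (Finset.single_le_sum (fun _ _ => zero_le) hmem)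
    have hsupp : ∀ i, P.mdp.prob P.ref (opt i) ≠ 0 := fun i => by
      have h1 := indep_support _ _ hopt i
      rw [hst.sampler] at h1
      exact h.effSampler_support hst.mem (P.mdp.trajLaw_support h1).2
    have hx : ∀ x : ℝ, log K < x → (1 : ℝ≥0∞) ≤ ENNReal.ofReal (exp x / K) := fun x hx => by
      rw [ENNReal.one_le_ofReal, le_div_iff₀ hK0, one_mul, ← Real.log_le_iff_le_exp hK0]
      exact hx.le
    by_cases h1 : a₁ z π ≤ log K
    · by_cases h2 : a₂ batch π ≤ log K
      · by_cases h3 : a₃ opt π ≤ log K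
        · have := stepOK_of_exponents h hα hupd hs hb hℓ st (by rw [hst.length]; omega) z batch opt
            hn hsupp hπ h1 h2 h3
          simp [this]
        · refine le_trans ?_ (le_add_left (le_add_left (hx _ (not_le.1 h3))))
          split_ifs <;> simp
      · refine le_trans ?_ (le_add_left (le_add_right (hx _ (not_le.1 h2))))
        split_ifs <;> simp
    · refine le_trans ?_ (le_add_right (hx _ (not_le.1 h1)))
      split_ifs <;> simp
  have b₁ : lexpect ((P.mdp.pairLaw (P.mdp.sampler st.current) st.sampler).bind P.mdp.label)
      (fun z => ∑ π ∈ P.cls, ENNReal.ofReal (exp (a₁ z π) / K)) ≤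
      (∑ π ∈ P.cls, ENNReal.ofReal (exp (P.onlineLlr πstar π st))) * ENNReal.ofReal (1 / K) := by
    rw [lexpect_sum, Finset.sum_mul]
    refine Finset.sum_le_sum fun π _ => ?_
    simp only [div_eq_mul_one_div (exp _) K, ENNReal.ofReal_mul (Real.exp_pos _).le]
    rw [lexpect_mul_const]
    gcongr
    exact hst.lexpect_onlineExp h π
  have b₂ : lexpect (indep P.γ fun _ => (PMF.uniformOfFintype (Fin N)).map off)
      (fun batch => ∑ π ∈ P.cls, ENNReal.ofReal (exp (a₂ batch π) / K)) ≤
      P.cls.card * ENNReal.ofReal (1 / K) := by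
    rw [lexpect_sum, ← nsmul_eq_mul, ← Finset.sum_const]
    exact Finset.sum_le_sum fun π hπ => lexpect_batch P π πstar s _ hK0 off (hoff.mean_le hB hπ) _
  have b₃ : lexpect (indep n fun _ => P.mdp.trajLaw st.sampler)
      (fun opt => ∑ π ∈ P.cls, ENNReal.ofReal (exp (a₃ opt π) / K)) ≤
      P.cls.card * ENNReal.ofReal (1 / K) := by
    rw [lexpect_sum, ← nsmul_eq_mul, ← Finset.sum_const, hst.sampler]
    refine Finset.sum_le_sum fun π hπ => lexpect_optimism hb (fun τ _ => ?_) _ hK0 n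
    have h1 := (h.ratio π hπ τ).2
    have h2 := (h.ratio πstar h.star_mem τ).2
    have h3 : V / P.β + V / P.β ≤ b / 2 := by
      rw [← two_mul, ← mul_div_assoc, div_le_iff₀ hβ]
      linarith
    exact (abs_sub _ _).trans (by linarith)
  calc _ ≤ lexpect ((P.mdp.pairLaw (P.mdp.sampler st.current) st.sampler).bind P.mdp.label)
        (fun z => lexpect (indep P.γ fun _ => (PMF.uniformOfFintype (Fin N)).map off) fun batch =>
          lexpect (indep n fun _ => P.mdp.trajLaw st.sampler) fun opt =>
          ∑ π ∈ P.cls, ENNReal.ofReal (exp (a₁ z π) / K) +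
        (∑ π ∈ P.cls, ENNReal.ofReal (exp (a₂ batch π) / K) +
          ∑ π ∈ P.cls, ENNReal.ofReal (exp (a₃ opt π) / K))) :=
        lexpect_mono fun z _ => lexpect_mono fun batch _ => lexpect_mono fun opt hopt =>
          key z batch opt hopt
    _ ≤ _ := by
        simp only [lexpect_add, lexpect_const]
        rw [two_mul, add_mul]
        gcongr

end iter

/-- All chosen policies satisfy the guarantee. -/
def AllOK (P : Problem S A H N) (πstar : Policy S A H) (α s b B ℓ : ℝ)
    (l : List (Policy S A H)) : Prop :=
  ∀ t, 1 ≤ t → t < l.length → P.StepOK πstar α s b B ℓ (l.take t) (l.getD t P.ref)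

lemma inv_start (h : P.Regular V R πstar) : P.Inv 0 P.start where
  length := rfl
  mem := fun π hπ => by
    rw [start, List.mem_singleton] at hπ
    exact hπ ▸ h.ref_mem
  current := rfl
  sampler := rfl

lemma AllOK.append {s b B ℓ : ℝ} {l : List (Policy S A H)} {π : Policy S A H}
    (hl : P.AllOK πstar α s b B ℓ l) (hπ : P.StepOK πstar α s b B ℓ l π) :
    P.AllOK πstar α s b B ℓ (l ++ [π]) := by
  intro t ht1 ht
  rw [List.length_append, List.length_singleton] at ht
  rcases (Nat.lt_succ_iff.1 ht).lt_or_eq with h1 | rfl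
  · rw [List.take_append_of_le_length h1.le, List.getD_append _ _ _ _ h1]
    exact hl t ht1 h1
  · rw [List.take_append_of_le_length le_rfl, List.take_length, List.getD_eq_getElem?_getD,
      List.getElem?_append_right le_rfl]
    simpa using hπ

section run

variable [NeZero N] {off : Fin N → Traj S A H × Traj S A H}

lemma inv_runFrom (h : P.Regular V R πstar) (hupd : P.IsArgminRule α upd) :
    ∀ (t : ℕ) (st : RunState S A H), P.runFrom upd off t st ≠ 0 → P.Inv t st
  | 0, st, hst => by
    have h1 : st ∈ (PMF.pure P.start).support := hst
    rw [PMF.support_pure, Set.mem_singleton_iff] at h1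
    exact h1 ▸ inv_start h
  | t + 1, st, hst => by
    have h1 : st ∈ ((P.runFrom upd off t).bind (P.iter upd off)).support := hst
    rw [PMF.mem_support_bind_iff] at h1
    obtain ⟨st₀, h0, h1⟩ := h1
    exact ((inv_runFrom h hupd t st₀ h0).iter hupd h1).1

lemma lexpect_runFrom_onlineLlr (h : P.Regular V R πstar) (hupd : P.IsArgminRule α upd)
    (π : Policy S A H) : ∀ t : ℕ, lexpect (P.runFrom upd off t)
      (fun st => ENNReal.ofReal (exp (P.onlineLlr πstar π st))) ≤ 1
  | 0 => by simp [runFrom, lexpect_pure, onlineLlr, start, cumHell]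
  | t + 1 => by
    rw [runFrom, lexpect_bind]
    exact (lexpect_mono fun st hst =>
      (inv_runFrom h hupd t st hst).lexpect_iter_onlineLlr h π).trans
        (lexpect_runFrom_onlineLlr h hupd π t)

-- Averaged over the run, the supermartingale is at most 1 for each policy, so the online term costs
-- one card/K; together with the batch and the optimism dataset each iteration costs three.
open Classical in
lemma lexpect_runFrom_not_allOK (h : P.Regular V R πstar) (hα : 0 ≤ α)
    (hupd : P.IsArgminRule α upd) {s b B K : ℝ} (hs : 0 < s) (hb : 0 < b) (hB : 0 < B)
    (hbV : 4 * V ≤ b * P.β) (hK : 1 < K) (hoff : P.OffOK πstar s B (log K) off) :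
    ∀ t : ℕ, lexpect (P.runFrom upd off t)
      (fun st => if ¬P.AllOK πstar α s b B (log K) st.policies then 1 else 0) ≤
        t * (3 * P.cls.card * ENNReal.ofReal (1 / K))
  | 0 => by
    rw [runFrom, lexpect_pure, if_neg]
    · simp
    · rw [not_not]
      intro t h1 h2
      simp only [start, List.length_singleton] at h2
      omega
  | t + 1 => by
    rw [runFrom, lexpect_bind]
    calc _ ≤ lexpect (P.runFrom upd off t) (fun st =>
          (if ¬P.AllOK πstar α s b B (log K) st.policies then 1 else 0) +
          ((∑ π ∈ P.cls, ENNReal.ofReal (exp (P.onlineLlr πstar π st))) * ENNReal.ofReal (1 / K) +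
        2 * P.cls.card * ENNReal.ofReal (1 / K))) := by
          refine lexpect_mono fun st hst => ?_
          have hinv := inv_runFrom h hupd t st hst
          refine le_trans ?_ (add_le_add_right
            (hinv.lexpect_iter_not_stepOK (off := off) h hα hupd hs hb hB hbV hK hoff) _)
          rw [← lexpect_const (P.iter upd off st)
            (if ¬P.AllOK πstar α s b B (log K) st.policies then 1 else 0), ← lexpect_add]
          refine lexpect_mono fun st' hst' => ?_
          rw [(hinv.iter hupd hst').2]
          by_cases h1 : P.AllOK πstar α s b B (log K) st.policies
          · by_cases h2 : P.StepOK πstar α s b B (log K) st.policies st'.current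
            · simp [h1.append h2]
            · rw [if_pos (c := ¬P.StepOK _ _ _ _ _ _ _ _) h2]
              refine le_trans ?_ le_add_self
              split_ifs <;> simp
          · rw [if_pos (c := ¬P.AllOK _ _ _ _ _ _ st.policies) h1]
            refine le_trans ?_ le_self_add
            split_ifs <;> simp
      _ ≤ t * (3 * P.cls.card * ENNReal.ofReal (1 / K)) +
          (P.cls.card * ENNReal.ofReal (1 / K) + 2 * P.cls.card * ENNReal.ofReal (1 / K)) := by
          rw [lexpect_add, lexpect_add, lexpect_mul_const, lexpect_const, lexpect_sum]
          gcongr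
          · exact lexpect_runFrom_not_allOK h hα hupd hs hb hB hbV hK hoff t
          · refine (Finset.sum_le_sum fun π _ => lexpect_runFrom_onlineLlr h hupd π t).trans ?_
            simp
      _ = _ := by
          push_cast
          ring

open Classical in
/-- With high probability, all chosen policies satisfy the guarantee. -/
lemma lexpect_run_not_allOK (h : P.Regular V R πstar) (hα : 0 ≤ α)
    (hupd : P.IsArgminRule α upd) {s b B K : ℝ} (hs : 0 < s) (hs4 : s ≤ 1 / 4)
    (hB : exp (s * (1 + R)) ≤ B) (hb : 0 < b) (hbV : 4 * V ≤ b * P.β) (hK : 1 < K) (T : ℕ) :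
    lexpect (P.run upd T)
      (fun st => if ¬(P.Inv T st ∧ P.AllOK πstar α s b B (log K) st.policies) then 1 else 0) ≤
        (3 * T + 1) * (P.cls.card * ENNReal.ofReal (1 / K)) := by
  have hB0 : 0 < B := (Real.exp_pos _).trans_le hB
  rw [run, lexpect_bind]
  calc _ ≤ lexpect (indep N fun i => P.mdp.label (P.offPairs i)) (fun off =>
        T * (3 * P.cls.card * ENNReal.ofReal (1 / K)) +
          if ¬P.OffOK πstar s B (log K) off then 1 else 0) := by
        refine lexpect_mono fun off _ => ?_
        by_cases h1 : P.OffOK πstar s B (log K) off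
        · rw [if_neg (not_not.2 h1), add_zero]
          refine le_trans (lexpect_mono fun st hst => ?_)
            (lexpect_runFrom_not_allOK h hα hupd hs hb hB0 hbV hK h1 T)
          simp [inv_runFrom h hupd T st hst]
        · rw [if_pos h1]
          refine le_trans (lexpect_le fun st _ => ?_) le_add_self
          split_ifs <;> simp
    _ ≤ T * (3 * P.cls.card * ENNReal.ofReal (1 / K)) +
        P.cls.card * ENNReal.ofReal (1 / K) := by
        rw [lexpect_add, lexpect_const]
        gcongr
        exact h.lexpect_not_offOK hs hs4 hB (by linarith)
    _ = _ := by ring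

end run

end Problem

/-! ### Sums over the rounds and tuning of the parameters -/

lemma inv_le_two_mul_log_sub {x : ℝ} (hx : 1 ≤ x) : 1 / x ≤ 2 * (log (x + 1) - log x) := by
  have hx0 : 0 < x := by linarith
  have h1 := Real.one_sub_inv_le_log_of_pos (x := (x + 1) / x) (by positivity)
  rw [Real.log_div (by linarith) hx0.ne', inv_div] at h1
  have h2 : 1 / x ≤ 2 * (1 - x / (x + 1)) := by
    rw [show 2 * (1 - x / (x + 1)) = 2 / (x + 1) by field_simp; ring,
      div_le_div_iff₀ hx0 (by linarith)]
    linarith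
  linarith

/-- The bound telescopes. Keeping γ in the ratio matters: for γ large compared with T the logarithm
is small, which offsets the factor γ/N of the offline error. -/
lemma sum_inv_le (γ : ℕ) {T : ℕ} (hT : 1 ≤ T) :
    ∑ k ∈ Finset.Ico 1 T, 1 / ((k + γ : ℕ) : ℝ) ≤ 2 * log (((T : ℝ) + γ) / (1 + γ)) := by
  rw [Real.log_div (by positivity) (by positivity)]
  induction T, hT using Nat.le_induction with
  | base => simp
  | succ n hn ih =>
    rw [Finset.sum_Ico_succ_top hn]
    have h1 : (1 : ℝ) ≤ n := by exact_mod_cast hn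
    have := inv_le_two_mul_log_sub (x := (n : ℝ) + γ) (by linarith [(Nat.cast_nonneg γ : (0 : ℝ) ≤ γ)])
    push_cast at ih ⊢
    rw [show (n : ℝ) + 1 + γ = n + γ + 1 by ring]
    linarith

lemma sum_inv_sqrt_le (γ : ℕ) {T : ℕ} (hT : 1 ≤ T) :
    ∑ k ∈ Finset.Ico 1 T, 1 / √((k + γ : ℕ) : ℝ) ≤ 2 * √T := by
  -- The sum is empty for T = 1, so the sharper bound with T − 1 starts the telescoping at zero.
  suffices h : ∑ k ∈ Finset.Ico 1 T, 1 / √((k + γ : ℕ) : ℝ) ≤ 2 * √((T : ℝ) - 1) by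
    refine h.trans ?_
    gcongr
    linarith
  induction T, hT using Nat.le_induction with
  | base => simp
  | succ n hn ih =>
    rw [Finset.sum_Ico_succ_top hn]
    have h1 : (1 : ℝ) ≤ n := by exact_mod_cast hn
    have h0 : 0 < √(n : ℝ) := Real.sqrt_pos.2 (by linarith)
    have h2 : 1 / √((n + γ : ℕ) : ℝ) ≤ 1 / √(n : ℝ) :=
      one_div_le_one_div_of_le h0 (Real.sqrt_le_sqrt (by push_cast; simp))
    have h3 : 2 * √((n : ℝ) - 1) + 1 / √(n : ℝ) ≤ 2 * √(n : ℝ) := by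
      rw [← le_sub_iff_add_le', div_le_iff₀ h0]
      have e1 := Real.sq_sqrt (show (0 : ℝ) ≤ n by linarith)
      have e2 := Real.sq_sqrt (show (0 : ℝ) ≤ (n : ℝ) - 1 by linarith)
      nlinarith [sq_nonneg (√(n : ℝ) - √((n : ℝ) - 1))]
    push_cast at ih h2 ⊢
    rw [add_sub_cancel_right]
    linarith

lemma half_le_log_two : 1 / 2 ≤ log 2 := by linarith [Real.log_two_gt_d9]

/-- A choice of the tempering exponent for which the statistical error of the offline batches is of
the optimal order in the sum over the rounds. -/
lemma exists_tempering {T γ N : ℕ} {R : ℝ} (hT : 2 ≤ T) (hN : 0 < N) (hγ : γ = 0 ∨ T ≤ N)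
    (hR : 0 ≤ R) (hRT : R ≤ log T) :
    ∃ s : ℝ, 0 < s ∧ s ≤ 1 / 4 ∧ log (((T : ℝ) + γ) / (1 + γ)) *
      ((1 + 2 * ((γ : ℝ) / N) * exp (s * (1 + R))) / s) ≤ 109 * log T := by
  have hT' : (2 : ℝ) ≤ T := by exact_mod_cast hT
  have hN' : (0 : ℝ) < N := by exact_mod_cast hN
  have hγ0 : (0 : ℝ) ≤ γ := Nat.cast_nonneg γ
  set r : ℝ := ((T : ℝ) + γ) / (1 + γ) with hr
  set Λ := log r with hΛ
  have hr1 : 1 ≤ r := by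
    rw [hr, one_le_div (by positivity)]
    linarith
  have hr0 : 0 < r := by linarith
  have hΛ0 : 0 ≤ Λ := Real.log_nonneg hr1
  have hτ : 1 / 2 ≤ log T := half_le_log_two.trans (Real.log_le_log (by norm_num) hT')
  have hΛT : Λ ≤ log T := by
    refine Real.log_le_log hr0 ?_
    rw [hr, div_le_iff₀ (by positivity)]
    nlinarith
  set ρ : ℝ := (γ : ℝ) / T with hρ
  have hρ0 : 0 ≤ ρ := by positivity
  -- From log r ≤ r − 1 ≤ T/(1 + γ): many offline draws make the harmonic sum short.
  have hρΛ : ρ * Λ ≤ 1 := by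
    have h1 : Λ ≤ T / (1 + γ) := by
      refine (Real.log_le_sub_one_of_pos hr0).trans ?_
      rw [hr, div_sub_one (by positivity)]
      gcongr
      linarith
    calc ρ * Λ ≤ ρ * (T / (1 + γ)) := by gcongr
      _ = γ / (1 + γ) := by rw [hρ]; field_simp
      _ ≤ 1 := by rw [div_le_one (by positivity)]; linarith
  have hlam : (γ : ℝ) / N ≤ ρ := by
    rcases hγ with h | h
    · simp [hρ, h]
    · have : (T : ℝ) ≤ N := by exact_mod_cast h
      rw [hρ]
      gcongr
  have hlam0 : 0 ≤ (γ : ℝ) / N := by positivity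
  have hρr : ρ * r ≤ 1 + ρ := by
    calc ρ * r = (γ / (1 + γ)) * (((T : ℝ) + γ) / T) := by rw [hρ, hr]; field_simp
      _ ≤ 1 * (((T : ℝ) + γ) / T) := by
        gcongr
        rw [div_le_one (by positivity)]
        linarith
      _ = 1 + ρ := by rw [hρ]; field_simp
  set m := max 1 Λ with hm
  have hm1 : 1 ≤ m := le_max_left _ _
  have hmΛ : Λ ≤ m := le_max_right _ _
  have hm0 : 0 < m := by linarith
  have hR1 : 0 < 1 + R := by linarith
  have hs0 : 0 < min (1 / 4) (m / (1 + R)) := lt_min (by norm_num) (by positivity)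
  -- This `s` keeps s(1 + R) ≤ max(1, Λ), so B ≤ max(e, r) ≤ 3 + r, and ρ(3 + r) is of order 1 + ρ.
  -- The resulting 1/s ≤ 4 + (1 + R)/m is affordable because R ≤ log T.
  refine ⟨min (1 / 4) (m / (1 + R)), hs0, min_le_left _ _, ?_⟩
  set s := min (1 / 4) (m / (1 + R)) with hs
  have hB : exp (s * (1 + R)) ≤ 3 + r := by
    have h1 : s * (1 + R) ≤ m := by
      rw [← le_div_iff₀ hR1]
      exact min_le_right _ _
    have h2 : exp m ≤ 3 + r := by
      rcases max_choice (1 : ℝ) Λ with h | h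
      · rw [hm, h]
        linarith [Real.exp_one_lt_d9]
      · rw [hm, h, hΛ, Real.exp_log hr0]
        linarith
    exact (Real.exp_le_exp.2 h1).trans h2
  have h1 : 1 + 2 * ((γ : ℝ) / N) * exp (s * (1 + R)) ≤ 3 + 8 * ρ := by
    have : (γ : ℝ) / N * exp (s * (1 + R)) ≤ ρ * (3 + r) := by gcongr
    linarith
  have h2 : 1 / s ≤ 4 + (1 + R) / m := by
    have h3 : 0 ≤ (1 + R) / m := by positivity
    rcases min_choice (1 / 4 : ℝ) (m / (1 + R)) with h | h
    · rw [hs, h]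
      norm_num
      exact h3
    · rw [hs, h, one_div_div]
      linarith
  have h3 : Λ * (3 + 8 * ρ) ≤ 3 * Λ + 8 := by linarith
  have h4 : (3 * Λ + 8) / m ≤ 11 := by
    rw [div_le_iff₀ hm0]
    linarith
  calc Λ * ((1 + 2 * ((γ : ℝ) / N) * exp (s * (1 + R))) / s)
      ≤ Λ * ((3 + 8 * ρ) / s) := by gcongr
    _ = (Λ * (3 + 8 * ρ)) * (1 / s) := by ring
    _ ≤ (3 * Λ + 8) * (4 + (1 + R) / m) := by gcongr
    _ = 4 * (3 * Λ + 8) + (1 + R) * ((3 * Λ + 8) / m) := by ring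
    -- With Λ, R ≤ log T the total is at most 23 log T + 43, and 43 ≤ 86 log T since log T ≥ 1/2.
    _ ≤ 4 * (3 * Λ + 8) + (1 + R) * 11 := by gcongr
    _ ≤ 109 * log T := by linarith

/-- The arithmetic of the tuning: all terms of the regret bound are of the order `κ · q`, where
`q² = (T + γ) · SEC · L · log T`. -/
lemma tuned_sum_le {ε W κ L τ T X q ℓ Λ J K₀ β α : ℝ} (hε : 0 < ε) (hWκ : W ≤ κ)
    (hκ : 0 < κ) (hβ : 0 < β) (hL : 1 / 2 ≤ L) (hτ : 1 / 2 ≤ τ) (hT : 2 ≤ T) (hX : 0 < X)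
    (hq : q = √(X * L * τ)) (hqT : ε * T ≤ X * τ)
    (hα : α = β / κ * √(L * τ / X)) (hℓ : ℓ ≤ 3 * L)
    (hΛ : Λ ≤ τ) (hΛ0 : 0 ≤ Λ) (hJ : Λ * J ≤ 109 * τ) (hJ0 : 0 ≤ J) :
    4 * W + 4 * W * √(2 * ℓ) * (2 * √T) + β / α * (2 * ℓ + J * ℓ + 1) * (2 * Λ) +
      α * (K₀ * κ ^ 2) / (8 * β) * X ≤
      (4 / √ε + 8 * √(6 / ε) + 670 + K₀ / 8) * (κ * q) := by
  have hL0 : 0 < L := by linarith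
  have hτ0 : 0 < τ := by linarith
  have hq0 : 0 < q := by rw [hq]; positivity
  have hq2 : q ^ 2 = X * L * τ := by rw [hq, Real.sq_sqrt (by positivity)]
  -- In this form β/α times L·τ and α κ²/β times X are both multiples of κ·q.
  have hα' : α = β * (L * τ) / (κ * q) := by
    have h1 : √(L * τ / X) = L * τ / q := by
      rw [Real.sqrt_eq_iff_mul_self_eq (by positivity) (by positivity)]
      rw [div_mul_div_comm, ← sq, ← sq, hq2]
      field_simp
    rw [hα, h1]
    field_simp
  have hεq : ε * T * L ≤ q ^ 2 := by
    rw [hq2]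
    calc ε * T * L ≤ X * τ * L := by gcongr
      _ = _ := by ring
  have t1 : 4 * W ≤ 4 / √ε * (κ * q) := by
    have h1 : √ε ≤ q := by
      rw [Real.sqrt_le_left hq0.le]
      refine le_trans ?_ hεq
      have : 1 ≤ T * L := by nlinarith
      nlinarith
    have h2 : 0 < √ε := Real.sqrt_pos.2 hε
    calc 4 * W ≤ 4 * κ := by gcongr
      _ = 4 / √ε * (κ * √ε) := by field_simp
      _ ≤ _ := by gcongr
  have t2 : 4 * W * √(2 * ℓ) * (2 * √T) ≤ 8 * √(6 / ε) * (κ * q) := by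
    have h1 : √(2 * ℓ) * √T ≤ √(6 / ε) * q := by
      rw [← Real.sqrt_mul' _ (by linarith), Real.sqrt_le_left (by positivity), mul_pow,
        Real.sq_sqrt (by positivity)]
      calc 2 * ℓ * T ≤ 2 * (3 * L) * T := by gcongr
        _ = 6 / ε * (ε * T * L) := by field_simp; ring
        _ ≤ _ := by gcongr
    calc 4 * W * √(2 * ℓ) * (2 * √T) = 8 * W * (√(2 * ℓ) * √T) := by ring
      _ ≤ 8 * κ * (√(6 / ε) * q) := by gcongr
      _ = _ := by ring
  have t3 : β / α * (2 * ℓ + J * ℓ + 1) * (2 * Λ) ≤ 670 * (κ * q) := by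
    have h1 : β / α = κ * q / (L * τ) := by
      rw [hα']
      field_simp
    have h2 : (2 * ℓ + J * ℓ + 1) * (2 * Λ) ≤ 670 * (L * τ) := by
      have h3 : (2 * ℓ + J * ℓ + 1) ≤ L * (8 + 3 * J) := by nlinarith
      calc (2 * ℓ + J * ℓ + 1) * (2 * Λ) ≤ L * (8 + 3 * J) * (2 * Λ) := by gcongr
        _ = L * (16 * Λ + 6 * (Λ * J)) := by ring
        _ ≤ L * (16 * τ + 6 * (109 * τ)) := by gcongr
        _ = _ := by ring
    calc β / α * (2 * ℓ + J * ℓ + 1) * (2 * Λ) =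
          κ * q / (L * τ) * ((2 * ℓ + J * ℓ + 1) * (2 * Λ)) := by rw [h1]; ring
      _ ≤ κ * q / (L * τ) * (670 * (L * τ)) := by gcongr
      _ = _ := by field_simp
  have t4 : α * (K₀ * κ ^ 2) / (8 * β) * X = K₀ / 8 * (κ * q) := by
    calc α * (K₀ * κ ^ 2) / (8 * β) * X = K₀ / 8 * κ * (X * L * τ) / q := by
          rw [hα']
          field_simp
      _ = _ := by rw [← hq2]; field_simp
  rw [t4]
  linarith

/-- The weighted AM-GM inequality behind the use of the extrapolation coefficient. -/
lemma le_of_sq_le_mul {x u v η : ℝ} (hu : 0 ≤ u) (hv : 0 ≤ v) (hη : 0 < η) (h : x ^ 2 ≤ u * v) :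
    x ≤ u / (2 * η) + η / 2 * v := by
  refine le_of_sq_le_sq (h.trans ?_) (by positivity)
  have e : (u / (2 * η) + η / 2 * v) ^ 2 = u * v + (u / (2 * η) - η / 2 * v) ^ 2 := by
    field_simp
    ring
  rw [e]
  linarith [sq_nonneg (u / (2 * η) - η / 2 * v)]

/-! ### From the guarantee of a round to its regret -/

namespace Problem

variable {S A : Type*} {H N : ℕ} {P : Problem S A H N} {V R α : ℝ} {πstar : Policy S A H}

lemma Regular.abs_J_integrand_le (h : P.Regular V R πstar) {π : Policy S A H} (hπ : π ∈ P.cls)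
    (τ : Traj S A H) : |P.mdp.totalReward τ - P.β * P.logRatio π τ| ≤ R + V := by
  refine (abs_sub _ _).trans (add_le_add ?_ (h.logRatio_le hπ τ))
  rw [abs_of_nonneg (h.reward τ).1]
  exact (h.reward τ).2

lemma Regular.regret_le (h : P.Regular V R πstar) {π : Policy S A H} (hπ : π ∈ P.cls) :
    P.J πstar - P.J π ≤ 2 * (V + R) := by
  have h1 := abs_le.1 (abs_expect_le (p := P.mdp.trajLaw (P.mdp.sampler πstar))
    fun τ _ => h.abs_J_integrand_le h.star_mem τ)
  have h2 := abs_le.1 (abs_expect_le (p := P.mdp.trajLaw (P.mdp.sampler π))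
    fun τ _ => h.abs_J_integrand_le hπ τ)
  unfold J
  linarith

lemma Regular.abs_g_le (h : P.Regular V R πstar) {π : Policy S A H} (hπ : π ∈ P.cls)
    (x : S × (Fin H → A) × (Fin H → A)) : |P.g π x| ≤ 2 * (V + R) := by
  have h1 := abs_le.1 (h.logRatio_le hπ (x.1, x.2.1))
  have h2 := abs_le.1 (h.logRatio_le hπ (x.1, x.2.2))
  have h3 := h.reward (x.1, x.2.1)
  have h4 := h.reward (x.1, x.2.2)
  rw [g, abs_le]
  constructor <;> linarith

lemma Regular.g_sq_le (h : P.Regular V R πstar) {π : Policy S A H} (hπ : π ∈ P.cls)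
    (x : S × (Fin H → A) × (Fin H → A)) : P.g π x ^ 2 ≤ 4 * (V + R) ^ 2 := by
  rw [← sq_abs, show 4 * (V + R) ^ 2 = (2 * (V + R)) ^ 2 by ring]
  exact pow_le_pow_left₀ (abs_nonneg _) (h.abs_g_le hπ x) 2

lemma Regular.abs_g_sq_le (h : P.Regular V R πstar) {π : Policy S A H} (hπ : π ∈ P.cls)
    (x : S × (Fin H → A) × (Fin H → A)) : |P.g π x ^ 2| ≤ 4 * (V + R) ^ 2 := by
  rw [abs_of_nonneg (sq_nonneg _)]
  exact h.g_sq_le hπ x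

lemma Regular.J_star (h : P.Regular V R πstar) :
    P.J πstar = expect P.mdp.init P.softValue := by
  rw [← P.mdp.trajLaw_map_fst (P.mdp.sampler πstar), expect_map (b := R), J]
  · refine expect_congr fun τ hτ => ?_
    obtain ⟨h1, h2⟩ := P.mdp.trajLaw_support hτ
    rw [optimal_logRatio h.β_pos h.reward h.ratio h.optimal h.star_mem h1
      (sampler_ref_ne_zero h.ratio h.star_mem h2)]
    ring
  · intro τ _
    have h2 := softValue_mem_Icc h.β_pos h.reward τ.1
    rw [abs_of_nonneg h2.1]
    exact h2.2

/-- The regret of a policy in terms of the implicit reward difference. -/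
lemma Regular.regret_eq (h : P.Regular V R πstar) {π : Policy S A H} (hπ : π ∈ P.cls)
    {q : Sampler S A H} (hq : ∀ s a, q s a ≠ 0 → P.mdp.prob P.ref (s, a) ≠ 0) :
    P.J πstar - P.J π =
      P.β * expect (P.mdp.trajLaw q) (fun τ => P.logRatio π τ - P.logRatio πstar τ) +
        expect (P.mdp.pairLaw (P.mdp.sampler π) q) (P.g π) := by
  set p := P.mdp.pairLaw (P.mdp.sampler π) q with hp
  have hc : ∀ s, |P.softValue s| ≤ R := fun s => by
    have h2 := softValue_mem_Icc h.β_pos h.reward s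
    rw [abs_of_nonneg h2.1]
    exact h2.2
  have hd : ∀ τ, |P.β * (P.logRatio π τ - P.logRatio πstar τ)| ≤ V + V := fun τ => by
    rw [mul_sub]
    exact (abs_sub _ _).trans (add_le_add (h.logRatio_le hπ τ) (h.logRatio_le h.star_mem τ))
  rw [h.J_star, J, ← expect_const_mul, ← P.mdp.trajLaw_map_fst (P.mdp.sampler π),
    ← P.mdp.pairLaw_map_left (P.mdp.sampler π) q, ← P.mdp.pairLaw_map_right (P.mdp.sampler π) q,
    PMF.map_comp, ← hp, expect_map (b := R) fun x _ => hc _,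
    expect_map (b := R + V) (f := fun τ => P.mdp.totalReward τ - P.β * P.logRatio π τ)
      fun x _ => h.abs_J_integrand_le hπ _,
    expect_map (b := V + V) (f := fun τ => P.β * (P.logRatio π τ - P.logRatio πstar τ)) fun x _ => hd _,
    ← expect_sub (b := R) (b' := R + V) (fun x _ => hc _)
      (fun x _ => h.abs_J_integrand_le hπ _),
    ← expect_add (b := V + V) (fun x _ => hd _) (fun x _ => h.abs_g_le hπ x)]
  -- All expectations now live on the same pair law, as its marginals share the initial state. The
  -- identity holds pointwise, the soft value being eliminated through the second trajectory.
  refine expect_congr fun x hx => ?_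
  have hx' := h.possible_of_pairLaw hπ hq hx
  have h1 := optimal_logRatio h.β_pos h.reward h.ratio h.optimal h.star_mem (τ := (x.1, x.2.2))
    hx'.1 hx'.2.2
  simp only [Function.comp, g, mul_sub]
  rw [h1]
  ring

/-- The lower bound ε on V + R absorbs the 1 in 1 + 2(V + R). The exponential e^R is relaxed to
e^{2R} to match the stated rate. -/
lemma Regular.g_sq_le_pairHell (h : P.Regular V R πstar) {ε : ℝ} (hε : 0 < ε)
    (hVR : ε ≤ V + R) {π : Policy S A H} (hπ : π ∈ P.cls)
    {x : S × (Fin H → A) × (Fin H → A)} (hx : P.Possible x) :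
    P.g π x ^ 2 ≤ 64 * (1 / ε + 2) ^ 2 * ((V + R) * exp (2 * R)) ^ 2 * P.pairHell π πstar x := by
  have h1 := h.abs_g_le hπ x
  rw [h.g_eq hx] at h1 ⊢
  refine (sub_sq_le_hell (h.abs_margin_star hx) h1).trans ?_
  refine mul_le_mul_of_nonneg_right ?_ (hell_nonneg _ _)
  have h2 : 1 + 2 * (V + R) ≤ (1 / ε + 2) * (V + R) := by
    have : 1 ≤ 1 / ε * (V + R) := by
      rw [one_div, ← div_eq_inv_mul, one_le_div hε]
      exact hVR
    linarith
  have h3 : exp R ≤ exp (2 * R) := Real.exp_le_exp.2 (by linarith [h.R_nonneg])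
  have h4 : 0 ≤ V + R := hε.le.trans hVR
  calc 64 * exp R ^ 2 * (1 + 2 * (V + R)) ^ 2
      ≤ 64 * exp (2 * R) ^ 2 * ((1 / ε + 2) * (V + R)) ^ 2 := by gcongr
    _ = _ := by ring

/-- The regret of a policy that satisfies the guarantee of its round. -/
lemma StepOK.regret_le (h : P.Regular V R πstar) {s b B ℓ κ' u D : ℝ}
    {l : List (Policy S A H)} {π : Policy S A H} (hl : ∀ π ∈ l, π ∈ P.cls) (hπ : π ∈ P.cls)
    (hlen : 0 < l.length) (hα : 0 < α) (hκ' : 0 < κ') (hκ : 10 * (V + R) ^ 2 ≤ κ')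
    (hg : ∀ x, P.Possible x → P.g π x ^ 2 ≤ κ' * P.pairHell π πstar x)
    (hu : 0 ≤ u) (hD0 : 0 ≤ D)
    (hD : D ≤ ∑ i ∈ Finset.range l.length, expect (P.roundLaw l i) (fun x => P.g π x ^ 2) +
      P.γ * P.Coff π + 4 * (V + R) ^ 2)
    (hsec : expect (P.mdp.pairLaw (P.mdp.sampler π) (P.effSampler l)) (P.g π) ^ 2 ≤
      u * max (V ^ 2) D)
    (hok : P.StepOK πstar α s b B ℓ l π) :
    P.J πstar - P.J π ≤
      P.β * b * √(2 * ℓ) * (1 / √((l.length + P.γ : ℕ) : ℝ)) +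
      P.β / α * (2 * ℓ + (1 + 2 * (P.γ / N) * B) / s * ℓ + 1) *
        (1 / ((l.length + P.γ : ℕ) : ℝ)) +
      α * κ' / (8 * P.β) * (u * ((l.length + P.γ : ℕ) : ℝ)) := by
  have hβ := h.β_pos
  rw [h.regret_eq hπ fun s a ha => h.effSampler_support hl ha]
  unfold StepOK at hok
  set n : ℝ := ((l.length + P.γ : ℕ) : ℝ) with hn
  have hn0 : 0 < n := by rw [hn]; exact_mod_cast (by omega : 0 < l.length + P.γ)
  set E := expect (P.mdp.trajLaw (P.effSampler l))
    (fun τ => P.logRatio π τ - P.logRatio πstar τ)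
  set G := expect (P.mdp.pairLaw (P.mdp.sampler π) (P.effSampler l)) (P.g π)
  set h₀ := P.cumHell πstar π l l.length + P.γ * P.offMean (P.pairHell π πstar) with hh₀
  -- the denominator of the extrapolation coefficient
  have hD' : max (V ^ 2) D ≤ κ' * h₀ + 5 * (V + R) ^ 2 := by
    have h1 : ∑ i ∈ Finset.range l.length, expect (P.roundLaw l i) (fun x => P.g π x ^ 2) ≤
        κ' * P.cumHell πstar π l l.length := by
      rw [cumHell, Finset.mul_sum]
      refine Finset.sum_le_sum fun i _ => ?_
      rw [← expect_const_mul]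
      refine expect_mono (b := 4 * (V + R) ^ 2) (b' := κ') (fun x _ => h.abs_g_sq_le hπ x)
        (fun x _ => ?_) fun x hx => hg x (h.possible_of_roundLaw hl hx)
      rw [abs_mul, abs_of_pos hκ']
      exact mul_le_of_le_one_right hκ'.le (abs_pairHell_le π πstar x)
    have h2 : P.Coff π ≤ κ' * P.offMean (P.pairHell π πstar) := by
      rw [Coff, offMean, one_div_mul_eq_div, mul_div_assoc', Finset.mul_sum]
      gcongr with i
      exact hg _ (h.offline i)
    have h3 : (P.γ : ℝ) * P.Coff π ≤ κ' * (P.γ * P.offMean (P.pairHell π πstar)) := by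
      calc (P.γ : ℝ) * P.Coff π ≤ P.γ * (κ' * P.offMean (P.pairHell π πstar)) := by gcongr
        _ = _ := by ring
    have h4 : V ^ 2 ≤ (V + R) ^ 2 :=
      pow_le_pow_left₀ h.V_nonneg (by linarith [h.R_nonneg]) 2
    rw [hh₀, mul_add]
    refine max_le ?_ ?_
    · linarith [sq_nonneg V]
    · linarith [sq_nonneg (V + R)]
  -- The AM-GM weight is chosen so that its Hellinger term (β/(αn))·2h₀ is exactly the one that the
  -- guarantee subtracts. The remaining 5(V+R)² contributes at most β/(αn), by 10(V+R)² ≤ κ'.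
  have hη : 0 < 4 * P.β / (α * n * κ') := by positivity
  have hG := le_of_sq_le_mul hu ((sq_nonneg V).trans (le_max_left _ _)) hη hsec
  have e1 : u / (2 * (4 * P.β / (α * n * κ'))) = α * κ' / (8 * P.β) * (u * n) := by
    field_simp
    ring
  have e2 : 4 * P.β / (α * n * κ') / 2 * max (V ^ 2) D ≤ P.β / α * (1 / n) * (2 * h₀ + 1) := by
    calc 4 * P.β / (α * n * κ') / 2 * max (V ^ 2) D
        ≤ 4 * P.β / (α * n * κ') / 2 * (κ' * h₀ + 5 * (V + R) ^ 2) := by gcongr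
      _ = P.β / α * (1 / n) * (2 * h₀ + 10 * (V + R) ^ 2 / κ') := by
        field_simp
        ring
      _ ≤ P.β / α * (1 / n) * (2 * h₀ + 1) := by
        gcongr
        rwa [div_le_one hκ']
  have e3 : P.β * E ≤ P.β * b * √(2 * ℓ) * (1 / √n) +
      P.β / α * (1 / n) * (2 * ℓ + (1 + 2 * (P.γ / N) * B) * ℓ / s - 2 * h₀) := by
    have h1 : √(2 * n * ℓ) = n * (√(2 * ℓ) * (1 / √n)) := by
      rw [show 2 * n * ℓ = n * (2 * ℓ) by ring, Real.sqrt_mul hn0.le]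
      have := Real.mul_self_sqrt hn0.le
      have h0 : √n ≠ 0 := (Real.sqrt_pos.2 hn0).ne'
      field_simp
      rw [sq, this, mul_comm]
    rw [h1] at hok
    have h2 : α * n * E ≤ α * n * (b * √(2 * ℓ) * (1 / √n)) +
        (2 * ℓ + (1 + 2 * (P.γ / N) * B) * ℓ / s - 2 * h₀) := by linarith
    calc P.β * E = P.β / α * (1 / n) * (α * n * E) := by field_simp
      _ ≤ P.β / α * (1 / n) * (α * n * (b * √(2 * ℓ) * (1 / √n)) +
        (2 * ℓ + (1 + 2 * (P.γ / N) * B) * ℓ / s - 2 * h₀)) := by gcongr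
      _ = _ := by field_simp
  rw [e1] at hG
  have e4 : (1 + 2 * ((P.γ : ℝ) / N) * B) * ℓ / s = (1 + 2 * (P.γ / N) * B) / s * ℓ := by ring
  rw [e4] at e3
  linarith

end Problem

/-! ### The extrapolation coefficient and the summed regret -/

namespace Problem

variable {S A : Type*} {H N : ℕ} {P : Problem S A H N} {V R α : ℝ} {πstar : Policy S A H}

lemma Coff_nonneg (π : Policy S A H) : 0 ≤ P.Coff π :=
  mul_nonneg (by positivity) (Finset.sum_nonneg fun _ _ => sq_nonneg _)

lemma secTerm_nonneg (V : ℝ) {T : ℕ} (seq : Fin T → Policy S A H) (k : Fin T) :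
    0 ≤ P.secTerm V seq k :=
  div_nonneg (sq_nonneg _) ((sq_nonneg V).trans (le_max_left _ _))

/-- The supremum runs over finitely many sequences, so it is genuinely attained as an upper bound.
-/
lemma sum_secTerm_le_SEC (V : ℝ) {T : ℕ} (seq : Fin T → Policy S A H)
    (hseq : ∀ i, seq i ∈ P.cls) : ∑ k, P.secTerm V seq k ≤ P.SEC V T :=
  le_ciSup (f := fun seq : Fin T → {π // π ∈ P.cls} =>
    ∑ k : Fin T, P.secTerm V (fun i => (seq i : Policy S A H)) k)
    (Set.finite_range _).bddAbove fun i => ⟨seq i, hseq i⟩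

lemma sum_fin_lt {T : ℕ} (F : ℕ → ℝ) (k : Fin T) :
    ∑ j : Fin T with j < k, F j = ∑ i ∈ Finset.range k, F i := by
  rw [Finset.sum_filter]
  have e : ∀ j : Fin T, (if j < k then F j else 0) =
      (fun i : ℕ => if i < (k : ℕ) then F i else 0) j := fun j => rfl
  simp only [e]
  rw [Fin.sum_univ_eq_sum_range (fun i : ℕ => if i < (k : ℕ) then F i else 0) T,
    ← Finset.sum_filter]
  refine Finset.sum_congr ?_ fun _ _ => rfl
  ext i
  simp only [Finset.mem_filter, Finset.mem_range]
  omega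

lemma take_ofFn_getD (pol : List (Policy S A H)) {T t : ℕ} (hT : T ≤ pol.length) (ht : t ≤ T) :
    (List.ofFn fun i : Fin T => pol.getD i P.ref).take t = pol.take t := by
  refine List.ext_getElem ?_ fun i h1 h2 => ?_
  · simp
    omega
  · simp only [List.length_take, List.length_ofFn] at h1
    have h3 : i < pol.length := by omega
    simp [List.getElem_take, List.getElem_ofFn, List.getElem?_eq_getElem h3]

/-- The extrapolation coefficient, for the samplers that the algorithm uses. -/
lemma Regular.exists_sec_bound (h : P.Regular V R πstar) {pol : List (Policy S A H)}
    (hpol : ∀ π ∈ pol, π ∈ P.cls) {T : ℕ} (hT : T ≤ pol.length) (k : Fin T) (hk : 2 ≤ (k : ℕ)) :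
    ∃ D : ℝ, 0 ≤ D ∧
      D ≤ ∑ i ∈ Finset.range (pol.take k).length, expect (P.roundLaw (pol.take k) i)
        (fun x => P.g (pol.getD k P.ref) x ^ 2) + P.γ * P.Coff (pol.getD k P.ref) +
          4 * (V + R) ^ 2 ∧
      expect (P.mdp.pairLaw (P.mdp.sampler (pol.getD k P.ref)) (P.effSampler (pol.take k)))
        (P.g (pol.getD k P.ref)) ^ 2 ≤
          P.secTerm V (fun i : Fin T => pol.getD i P.ref) k * max (V ^ 2) D := by
  have hlen : (pol.take k).length = k := by
    rw [List.length_take]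
    omega
  have hπ := h.getD_mem hpol (k : ℕ)
  set π := pol.getD k P.ref with hπd
  have hs : ∀ t ≤ T, P.sampAt (fun i : Fin T => pol.getD i P.ref) t = P.samp (pol.take t) :=
    fun t ht => by rw [sampAt, take_ofFn_getD pol hT ht]
  refine ⟨∑ j : Fin T with j < k, expect (P.mdp.pairLaw (P.mdp.sampler (pol.getD j P.ref))
      (P.sampAt (fun i : Fin T => pol.getD i P.ref) (j + 1))) (fun x => P.g π x ^ 2) +
        P.γ * P.Coff π, ?_, ?_, ?_⟩
  · exact add_nonneg (Finset.sum_nonneg fun j _ => expect_nonneg fun x _ => sq_nonneg _)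
      (mul_nonneg (Nat.cast_nonneg _) (Coff_nonneg π))
  · rw [sum_fin_lt (fun j => expect (P.mdp.pairLaw (P.mdp.sampler (pol.getD j P.ref))
      (P.sampAt (fun i : Fin T => pol.getD i P.ref) (j + 1))) (fun x => P.g π x ^ 2)) k, hlen]
    have h1 : ∀ i ∈ Finset.range k, expect (P.mdp.pairLaw (P.mdp.sampler (pol.getD i P.ref))
        (P.sampAt (fun i : Fin T => pol.getD i P.ref) (i + 1))) (fun x => P.g π x ^ 2) ≤
        expect (P.roundLaw (pol.take k) i) (fun x => P.g π x ^ 2) +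
          if i = 0 then 4 * (V + R) ^ 2 else 0 := by
      intro i hi
      rw [Finset.mem_range] at hi
      rw [P.roundLaw_take pol hi]
      -- Only round i = 0 differs: the coefficient uses `samp` on the first policy, the algorithm
      -- plays `π_ref`. That term is replaced by its trivial bound 4(V + R)².
      split_ifs with h0
      · refine le_add_of_nonneg_of_le (expect_nonneg fun x _ => sq_nonneg _) ?_
        exact expect_le (fun x _ => h.abs_g_sq_le hπ x) fun x _ => h.g_sq_le hπ x
      · rw [add_zero, roundLaw, effSampler, if_neg, hs _ (by omega)]
        rw [List.length_take]
        omega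
    have h2 := Finset.sum_le_sum h1
    rw [Finset.sum_add_distrib, Finset.sum_ite_eq' (Finset.range k) 0, if_pos
      (Finset.mem_range.2 (by omega))] at h2
    linarith
  · rw [secTerm, effSampler, if_neg (by omega), hs _ k.2.le, ← hπd]
    set D := ∑ j : Fin T with j < k, expect (P.mdp.pairLaw (P.mdp.sampler (pol.getD j P.ref))
      (P.sampAt (fun i : Fin T => pol.getD i P.ref) (j + 1))) (fun x => P.g π x ^ 2) +
        P.γ * P.Coff π
    -- A vanishing denominator makes the quotient zero by convention. It forces V = 0, so all
    -- log-ratios vanish and g is zero on possible pairs.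
    by_cases hm : max (V ^ 2) D = 0
    · have hV : V = 0 := by
        have := le_max_left (V ^ 2) D
        rw [hm] at this
        exact pow_eq_zero_iff two_ne_zero |>.1 (le_antisymm this (sq_nonneg V))
      have hz : expect (P.mdp.pairLaw (P.mdp.sampler π) (P.samp (pol.take k))) (P.g π) = 0 := by
        rw [← expect_const (P.mdp.pairLaw (P.mdp.sampler π) (P.samp (pol.take k))) 0]
        refine expect_congr fun x hx => ?_
        have hx' := h.possible_of_pairLaw hπ (fun s a ha h0 =>
          ha (h.samp _ (fun π hπ => hpol π (List.mem_of_mem_take hπ)) s a h0)) hx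
        have h0 : ∀ π' ∈ P.cls, ∀ τ, P.β * P.logRatio π' τ = 0 := fun π' h' τ =>
          abs_eq_zero.1 (le_antisymm (hV ▸ h.logRatio_le h' τ) (abs_nonneg _))
        rw [h.g_eq hx', margin, margin, h0 _ hπ, h0 _ hπ, h0 _ h.star_mem, h0 _ h.star_mem]
        ring
      rw [hz, hm]
      simp
    · rw [div_mul_cancel₀ _ hm]

/-- The sum of the regrets of `π⁽¹⁾, …, π⁽ᵀ⁾`, when all of them satisfy their guarantees. -/
lemma AllOK.sum_regret_le (h : P.Regular V R πstar) {s b B ℓ κ' : ℝ} {T : ℕ} (hT : 2 ≤ T)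
    {pol : List (Policy S A H)} (hlen : T ≤ pol.length) (hpol : ∀ π ∈ pol, π ∈ P.cls)
    (hα : 0 < α) (hs : 0 < s) (hb : 0 < b) (hB : 0 < B) (hℓ : 0 < ℓ) (hκ' : 0 < κ')
    (hκ : 10 * (V + R) ^ 2 ≤ κ')
    (hg : ∀ π ∈ P.cls, ∀ x, P.Possible x → P.g π x ^ 2 ≤ κ' * P.pairHell π πstar x)
    (hok : P.AllOK πstar α s b B ℓ pol) :
    ∑ k : Fin T, (P.J πstar - P.J (pol.getD k P.ref)) ≤
      4 * (V + R) + P.β * b * √(2 * ℓ) * (2 * √T) +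
        P.β / α * (2 * ℓ + (1 + 2 * (P.γ / N) * B) / s * ℓ + 1) *
          (2 * log (((T : ℝ) + P.γ) / (1 + P.γ))) +
        α * κ' / (8 * P.β) * (((T : ℝ) + P.γ) * P.SEC V T) := by
  have hβ := h.β_pos
  have hVR : 0 ≤ V + R := add_nonneg h.V_nonneg h.R_nonneg
  set a₁ := P.β * b * √(2 * ℓ) with ha₁
  set a₂ := P.β / α * (2 * ℓ + (1 + 2 * (P.γ / N) * B) / s * ℓ + 1) with ha₂
  set a₃ := α * κ' / (8 * P.β) with ha₃
  have ha₁0 : 0 ≤ a₁ := by positivity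
  have ha₂0 : 0 ≤ a₂ := by positivity
  have ha₃0 : 0 ≤ a₃ := by positivity
  set u : Fin T → ℝ := fun k => P.secTerm V (fun i : Fin T => pol.getD i P.ref) k with hu
  have hu0 : ∀ k, 0 ≤ u k := fun k => secTerm_nonneg V _ k
  set F : ℕ → ℝ := fun k => (if k < 2 then 2 * (V + R) else 0) + (if 1 ≤ k then
    a₁ * (1 / √((k + P.γ : ℕ) : ℝ)) + a₂ * (1 / ((k + P.γ : ℕ) : ℝ)) else 0) with hF
  have hround : ∀ k : Fin T, P.J πstar - P.J (pol.getD k P.ref) ≤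
      F k + a₃ * (u k * ((T : ℝ) + P.γ)) := by
    intro k
    have hπ := h.getD_mem hpol (k : ℕ)
    have hpos : 0 ≤ a₃ * (u k * ((T : ℝ) + P.γ)) := mul_nonneg ha₃0 (mul_nonneg (hu0 k) (by positivity))
    -- The first policy is not chosen by an update, and for the second one the algorithm's sampler
    -- `π_ref` differs from that in the coefficient. Both are charged the trivial regret 2(V + R).
    by_cases hk : (k : ℕ) < 2
    · have h1 : 2 * (V + R) ≤ F k := by
        simp only [hF, if_pos hk]
        refine le_add_of_nonneg_right ?_
        split_ifs <;> positivity
      linarith [h.regret_le hπ]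
    · have hlk : (pol.take k).length = k := by
        rw [List.length_take]
        omega
      obtain ⟨D, hD0, hD, hsec⟩ := h.exists_sec_bound hpol hlen k (by omega)
      have h1 := StepOK.regret_le h (fun π hπ => hpol π (List.mem_of_mem_take hπ)) hπ
        (by omega) hα hκ' hκ (hg _ hπ) (hu0 k) hD0 hD hsec (hok k (by omega) (by omega))
      rw [hlk, ← ha₁, ← ha₂, ← ha₃] at h1
      have h2 : u k * ((k + P.γ : ℕ) : ℝ) ≤ u k * ((T : ℝ) + P.γ) := by
        refine mul_le_mul_of_nonneg_left ?_ (hu0 k)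
        push_cast
        have : ((k : ℕ) : ℝ) ≤ T := by exact_mod_cast k.2.le
        linarith
      simp only [hF, if_neg hk, if_pos (show 1 ≤ (k : ℕ) by omega), zero_add]
      linarith [mul_le_mul_of_nonneg_left h2 ha₃0]
  refine (Finset.sum_le_sum fun k _ => hround k).trans ?_
  rw [Finset.sum_add_distrib, ← Finset.mul_sum, ← Finset.sum_mul,
    Fin.sum_univ_eq_sum_range F T]
  have h1 : ∑ k ∈ Finset.range T, F k ≤ 4 * (V + R) + a₁ * (2 * √T) +
      a₂ * (2 * log (((T : ℝ) + P.γ) / (1 + P.γ))) := by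
    simp only [hF]
    rw [Finset.sum_add_distrib, ← Finset.sum_filter, ← Finset.sum_filter]
    have e1 : Finset.filter (fun k => k < 2) (Finset.range T) = Finset.range 2 := by
      ext i
      simp only [Finset.mem_filter, Finset.mem_range]
      omega
    have e2 : Finset.filter (fun k => 1 ≤ k) (Finset.range T) = Finset.Ico 1 T := by
      ext i
      simp only [Finset.mem_filter, Finset.mem_range, Finset.mem_Ico]
      omega
    rw [e1, e2, Finset.sum_const, Finset.card_range, Finset.sum_add_distrib, ← Finset.mul_sum,
      ← Finset.mul_sum, nsmul_eq_mul]
    have h3 := mul_le_mul_of_nonneg_left (sum_inv_sqrt_le P.γ (T := T) (by omega)) ha₁0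
    have h4 := mul_le_mul_of_nonneg_left (sum_inv_le P.γ (T := T) (by omega)) ha₂0
    push_cast at h3 h4 ⊢
    linarith
  have h2 : (∑ k, u k) * ((T : ℝ) + P.γ) ≤ ((T : ℝ) + P.γ) * P.SEC V T := by
    rw [mul_comm]
    refine mul_le_mul_of_nonneg_left ?_ (by positivity)
    exact sum_secTerm_le_SEC V _ fun i => h.getD_mem hpol _
  linarith [mul_le_mul_of_nonneg_left h2 ha₃0]

end Problem

/-- If the regret bound is below the trivial one, then the rewards are at most logarithmic. -/
lemma reward_le_log {ε C R W T L q : ℝ} (hε : 0 < ε) (hW : 0 < W) (hT : 0 < T) (hL : 1 / 2 ≤ L)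
    (hR : 0 ≤ R) (hq : 0 ≤ q) (hqT : ε * T * L ≤ q ^ 2) (hC : 8 * √(6 / ε) ≤ C)
    (h : C * (W * Real.exp (2 * R) * (q / T)) < 2 * W) : R ≤ Real.log T := by
  have hE : 0 < Real.exp (2 * R) := Real.exp_pos _
  have hC0 : 0 ≤ C := le_trans (by positivity) hC
  have h1 : C * Real.exp (2 * R) * q < 2 * T := by
    have h2 : W * (C * Real.exp (2 * R) * q) < W * (2 * T) := by
      calc W * (C * Real.exp (2 * R) * q) = C * (W * Real.exp (2 * R) * (q / T)) * T := by
            field_simp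
        _ < 2 * W * T := by gcongr
        _ = _ := by ring
    exact lt_of_mul_lt_mul_left h2 hW.le
  have h2 : (C * Real.exp (2 * R) * q) ^ 2 < (2 * T) ^ 2 := by gcongr
  have h3 : 384 / ε ≤ C ^ 2 := by
    calc 384 / ε = (8 * √(6 / ε)) ^ 2 := by
          rw [mul_pow, Real.sq_sqrt (by positivity)]
          ring
      _ ≤ C ^ 2 := by gcongr
  have h4 : 192 * T * Real.exp (2 * R) ^ 2 ≤ (C * Real.exp (2 * R) * q) ^ 2 := by
    calc 192 * T * Real.exp (2 * R) ^ 2 = 384 / ε * Real.exp (2 * R) ^ 2 * (ε * T * (1 / 2)) := by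
          field_simp
          norm_num
      _ ≤ C ^ 2 * Real.exp (2 * R) ^ 2 * q ^ 2 := by
          gcongr
          exact le_trans (by gcongr) hqT
      _ = _ := by ring
  have h5 : Real.exp (2 * R) ^ 2 ≤ T := by
    have : T * (192 * Real.exp (2 * R) ^ 2) < T * (4 * T) := by
      calc T * (192 * Real.exp (2 * R) ^ 2) = 192 * T * Real.exp (2 * R) ^ 2 := by ring
        _ < (2 * T) ^ 2 := h4.trans_lt h2
        _ = _ := by ring
    have := lt_of_mul_lt_mul_left this hT.le
    linarith
  -- In fact 4R ≤ log T holds here.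
  rw [← Real.exp_nat_mul, ← Real.le_log_iff_exp_le hT] at h5
  push_cast at h5
  linarith

end

end HPO

/-! ### Assembly of the main theorem -/

theorem theorem1 :
    ∃ c : ℝ, 0 < c ∧ ∀ ε : ℝ, 0 < ε → ∃ C : ℝ, 0 < C ∧
      ∀ (S A : Type*) (H N T : ℕ) [NeZero N] (P : HPO.Problem S A H N) (V R δ : ℝ)
        (πstar : HPO.Policy S A H) (α : ℝ) (upd : HPO.UpdateRule S A H),
        -- standing assumptions
        0 < P.β → 2 ≤ T → 0 < δ → δ < 1 →
        (P.γ = 0 ∨ T ≤ N) →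
        P.ref ∈ P.cls → P.OfflinePossible → P.SampPossible → P.RewardBounded R →
        -- policy realizability and bounded log density ratios
        P.IsOptimal πstar → πstar ∈ P.cls → P.RatioBounded V →
        -- nondegeneracy of the scale and of the coefficient
        ε ≤ V + R →
        ε ≤ (1 + (P.γ : ℝ) / T) * P.SEC V T * Real.log T →
        -- choice of the optimism parameter, and the policy update
        α = c * (P.β / ((V + R) * Real.exp (2 * R))) *
          √(Real.log ((P.cls.card : ℝ) * T * δ⁻¹) * Real.log T / (((T : ℝ) + P.γ) * P.SEC V T)) →
        P.IsArgminRule α upd →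
        ENNReal.ofReal (1 - δ) ≤
          (P.run upd T).toOuterMeasure
            {st | ∀ πhat, P.IsOutput T st πhat →
              P.J πstar - P.J πhat ≤
                C * ((V + R) * Real.exp (2 * R) *
                  √((1 + (P.γ : ℝ) / T) * P.SEC V T *
                    Real.log ((P.cls.card : ℝ) * T * δ⁻¹) * Real.log T / T))} := by
  refine ⟨1, one_pos, fun ε hε => ⟨4 / √ε + 8 * √(6 / ε) + 670 + 64 * (1 / ε + 2) ^ 2 / 8,
    by positivity, ?_⟩⟩
  intro S A H N T _ P V R δ πstar α upd hβ hT hδ hδ1 hγ href hoff hsamp hrew hopt hstar hratio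
    hVR hsec hα hupd
  have h : P.Regular V R πstar := ⟨hβ, href, hoff, hsamp, hrew, hopt, hstar, hratio⟩
  have hR := h.R_nonneg
  have hW : 0 < V + R := hε.trans_le hVR
  have hT' : (2 : ℝ) ≤ T := by exact_mod_cast hT
  have hcard : (1 : ℝ) ≤ P.cls.card := by
    exact_mod_cast Finset.card_pos.2 ⟨_, href⟩
  have hγ0 : (0 : ℝ) ≤ P.γ := Nat.cast_nonneg _
  set K₀ : ℝ := 64 * (1 / ε + 2) ^ 2 with hK₀
  set C : ℝ := 4 / √ε + 8 * √(6 / ε) + 670 + K₀ / 8 with hC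
  set κ : ℝ := (V + R) * Real.exp (2 * R) with hκ
  set L : ℝ := Real.log ((P.cls.card : ℝ) * T * δ⁻¹) with hL
  set τ : ℝ := Real.log T with hτ
  set X : ℝ := ((T : ℝ) + P.γ) * P.SEC V T with hX
  set q : ℝ := √(X * L * τ) with hq
  have hM : 2 ≤ (P.cls.card : ℝ) * T * δ⁻¹ := by
    have h1 : 1 ≤ δ⁻¹ := (one_le_inv₀ hδ).2 hδ1.le
    have h2 : 2 ≤ (P.cls.card : ℝ) * T := by nlinarith
    nlinarith
  have hL2 : Real.log 2 ≤ L := Real.log_le_log (by norm_num) hM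
  have hL1 : 1 / 2 ≤ L := HPO.half_le_log_two.trans hL2
  have hL0 : 0 < L := by linarith
  have hτ1 : 1 / 2 ≤ τ := HPO.half_le_log_two.trans (Real.log_le_log (by norm_num) hT')
  have hτ0 : 0 < τ := by linarith
  have hXT : ε * T ≤ X * τ := by
    calc ε * T ≤ (1 + (P.γ : ℝ) / T) * P.SEC V T * τ * T := by gcongr
      _ = X * τ := by rw [hX]; field_simp
  have hX0 : 0 < X := by
    have h1 : 0 < X * τ := lt_of_lt_of_le (by positivity) hXT
    exact pos_of_mul_pos_left h1 hτ0.le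
  have hq2 : ε * T * L ≤ q ^ 2 := by
    rw [hq, Real.sq_sqrt (by positivity)]
    calc ε * T * L ≤ X * τ * L := by gcongr
      _ = _ := by ring
  have hrate : √((1 + (P.γ : ℝ) / T) * P.SEC V T * L * τ / T) = q / T := by
    rw [hq, ← Real.sqrt_sq (show (0 : ℝ) ≤ T by positivity), ← Real.sqrt_div' _ (by positivity),
      Real.sqrt_sq (by positivity)]
    congr 1
    rw [hX]
    field_simp
  have hWκ : V + R ≤ κ := le_mul_of_one_le_right hW.le (Real.one_le_exp (by positivity))
  have hκ0 : 0 < κ := by positivity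
  rw [one_mul] at hα
  have hα0 : 0 < α := by rw [hα]; positivity
  -- the tempering exponent
  obtain ⟨s, hs0, hs4, hs⟩ : ∃ s : ℝ, 0 < s ∧ s ≤ 1 / 4 ∧ (¬2 * (V + R) ≤ C * (κ * (q / T)) →
      Real.log (((T : ℝ) + P.γ) / (1 + P.γ)) *
        ((1 + 2 * ((P.γ : ℝ) / N) * Real.exp (s * (1 + R))) / s) ≤ 109 * Real.log T) := by
    by_cases htriv : 2 * (V + R) ≤ C * (κ * (q / T))
    · exact ⟨1 / 4, by norm_num, le_rfl, fun hn => absurd htriv hn⟩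
    · obtain ⟨s, h1, h2, h3⟩ := HPO.exists_tempering hT (NeZero.pos N) hγ hR
        (HPO.reward_le_log (C := C) hε hW (by linarith) hL1 hR (Real.sqrt_nonneg _) hq2
          (by rw [hC]; linarith [show 0 ≤ 4 / √ε by positivity, show 0 ≤ K₀ / 8 by positivity])
          (not_le.1 htriv))
      exact ⟨s, h1, h2, fun _ => h3⟩
  -- The failure probability is at most (3T + 1)·card/K: three events per iteration and one for the
  -- offline labels. This K makes it (3T + 1)δ/(4T) ≤ δ.
  set K : ℝ := 4 * ((P.cls.card : ℝ) * T * δ⁻¹) with hK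
  have hK1 : 1 < K := by linarith
  have hℓ : Real.log K ≤ 3 * L := by
    rw [hK, Real.log_mul (by norm_num) (by positivity), show (4 : ℝ) = 2 ^ 2 by norm_num,
      Real.log_pow]
    push_cast
    linarith
  have hℓ0 : 0 < Real.log K := Real.log_pos hK1
  -- The range 4V/β would suffice for the optimism dataset; V + R keeps `b` positive when V = 0.
  set b : ℝ := 4 * (V + R) / P.β with hb
  have hb0 : 0 < b := by positivity
  have hbβ : P.β * b = 4 * (V + R) := by rw [hb]; field_simp
  set B := Real.exp (s * (1 + R)) with hB
  have hbad := HPO.Problem.lexpect_run_not_allOK h hα0.le hupd hs0 hs4 (B := B) le_rfl hb0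
    (by rw [mul_comm b, hbβ]; linarith) hK1 T
  refine HPO.ofReal_one_sub_le_toOuterMeasure hδ.le (le_trans (HPO.lexpect_mono fun st _ => ?_)
    (hbad.trans ?_))
  · by_cases hst : P.Inv T st ∧ P.AllOK πstar α s b B (Real.log K) st.policies
    · rw [if_neg (not_not.2 hst), Set.indicator_of_notMem]
      rw [Set.notMem_compl_iff, Set.mem_ofPred_eq]
      rintro πhat ⟨hmem, hbest⟩
      obtain ⟨hinv, hok⟩ := hst
      have hlen : T ≤ st.policies.length := by rw [hinv.length]; omega
      have hhat : πhat ∈ P.cls := hinv.mem _ (List.mem_of_mem_take hmem)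
      rw [hrate]
      by_cases htriv : 2 * (V + R) ≤ C * (κ * (q / T))
      · exact (h.regret_le hhat).trans htriv
      · have hsum := HPO.Problem.AllOK.sum_regret_le (κ' := K₀ * κ ^ 2) h hT hlen hinv.mem hα0 hs0 hb0
          (Real.exp_pos _) hℓ0 (by positivity) ?_
          (fun π hπ x hx => h.g_sq_le_pairHell hε hVR hπ hx) hok
        · have hΛ0 : 1 ≤ ((T : ℝ) + P.γ) / (1 + P.γ) := by
            rw [one_le_div (by positivity)]
            linarith
          have hΛ : ((T : ℝ) + P.γ) / (1 + P.γ) ≤ T := by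
            rw [div_le_iff₀ (by positivity)]
            linarith [mul_le_mul_of_nonneg_right (show (1 : ℝ) ≤ T by linarith) hγ0]
          rw [hbβ] at hsum
          have htot := hsum.trans (HPO.tuned_sum_le (κ := κ) (K₀ := K₀) hε hWκ hκ0 hβ hL1 hτ1 hT' hX0
            hq hXT hα hℓ (Real.log_le_log (by positivity) hΛ) (Real.log_nonneg hΛ0) (hs htriv)
            (by positivity))
          -- The output is the best of the T policies, so its regret is at most their average
          -- regret.
          have hle : (T : ℝ) * (P.J πstar - P.J πhat) ≤
              ∑ k : Fin T, (P.J πstar - P.J (st.policies.getD k P.ref)) := by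
            rw [show (T : ℝ) * (P.J πstar - P.J πhat) =
              ∑ _k : Fin T, (P.J πstar - P.J πhat) by simp [mul_sub]]
            refine Finset.sum_le_sum fun k _ => sub_le_sub_left (hbest _ ?_) _
            have hk : (k : ℕ) < st.policies.length := k.2.trans_le hlen
            rw [List.getD_eq_getElem?_getD, List.getElem?_eq_getElem hk, Option.getD_some]
            exact List.mem_take_iff_getElem.2 ⟨k, by omega, rfl⟩
          have h1 : C * (κ * (q / T)) = C * (κ * q) / T := by ring
          rw [h1, le_div_iff₀ (by linarith), mul_comm]
          exact hle.trans htot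
        · have h1 : 10 ≤ K₀ := by
            have h2 : (2 : ℝ) ^ 2 ≤ (1 / ε + 2) ^ 2 :=
              pow_le_pow_left₀ (by norm_num) (by linarith [one_div_pos.2 hε]) 2
            linarith
          gcongr
    · rw [if_pos hst]
      exact Set.indicator_le_self' (fun _ _ => zero_le) st
  · have h1 : (3 * T + 1 : ENNReal) * (P.cls.card * ENNReal.ofReal (1 / K)) =
        ENNReal.ofReal ((3 * T + 1) * (P.cls.card * (1 / K))) := by
      rw [ENNReal.ofReal_mul (by positivity), ENNReal.ofReal_mul (by positivity),
        ENNReal.ofReal_add (by positivity) one_pos.le, ENNReal.ofReal_mul (by norm_num)]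
      simp
    rw [h1]
    refine ENNReal.ofReal_le_ofReal ?_
    have h2 : ((P.cls.card : ℝ) * (1 / K)) = δ / (4 * T) := by
      rw [hK]
      field_simp
    rw [h2, ← mul_div_assoc, div_le_iff₀ (by positivity)]
    linarith [mul_le_mul_of_nonneg_right (show (1 : ℝ) ≤ T by linarith) hδ.le]
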